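/- For $\varepsilon>0$ consider on $\mathbb{R}^3$ the system $$ \begin{cases} \partial_t u+\nabla p=\Delta u-(u\cdot\nabla)u-\tfrac12(\operatorname{div}u)\,u,\\ \partial_t\theta+u\cdot\nabla\theta=\Delta\theta-\tfrac12(\operatorname{div}u)\,\theta,\\ \varepsilon\,\partial_t p+\operatorname{div}u=0, \end{cases}\qquad (1) $$ with unknowns $u(x,t)\in\mathbb{R}^3$, $\theta(x,t)\in\mathbb{R}$, $p(x,t)\in\mathbb{R}$ and initial data $u(\cdot,0)=u_0$, $\theta(\cdot,0)=\theta_0$, $p(\cdot,0)=p_0$ in $L^2(\mathbb{R}^3)$. A weak solution of (1) on $\mathbb{R}^3\times[0,S)$ is a triple $(u,\theta,p)$ with $u,\theta\in L^\infty([0,S];L^2(\mathbb{R}^3))\cap L^2([0,S];\dot H^1(\mathbb{R}^3))$ and $\sqrt{\varepsilon}\,p\in L^\infty([0,S];L^2(\mathbb{R}^3))$ that satisfies (1) together with the initial conditions in the sense of distributions (tested with functions in $C_c^\infty([0,S)\times\mathbb{R}^3)$) and the energy inequality $$ E(t)+\int_0^t\!\!\int_{\mathbb{R}^3}\bigl(|\nabla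 u|^2+|\nabla\theta|^2\bigr)\,dx\,ds\le E(0)\quad\text{for a.e. }t\in(0,S),\qquad E(t)=\int_{\mathbb{R}^3}\Bigl(\tfrac12|u|^2+\tfrac12|\theta|^2+\tfrac{\varepsilon}{2}|p|^2\Bigr)(x,t)\,dx, $$ where $E(0)$ is computed from $u_0,\theta_0,p_0$. Let $P$ be the Leray projector, i.e. the orthogonal projector of $L^2(\mathbb{R}^3)^3$ onto the space of divergence free vector fields. Let $\varepsilon_n>0$, $\varepsilon_n\to0$, and let $u_0^{n},\theta_0^{n},p_0^{n}\in L^2(\mathbb{R}^3)$ be initial data such that, strongly in $L^2(\mathbb{R}^3)$, $$u_0^{n}\to u_0,\qquad \theta_0^{n}\to\theta_0,\qquad \sqrt{\varepsilon_n}\,p_0^{n}\to0 .$$ Then for every $T>0$ there is a constant $C_T$, depending only on $T$ and on the given sequences $\varepsilon_n,u_0^n,\theta_0^n,p_0^n$ (in particular neither on $n$ and $h$ nor on the solutions), such that for every $n$, every $h\in(0,1)$, every $S\ge T+h$ and every weak solution $(u^{n},\theta^{n},p^{n})$ of (1) on $\mathbb{R}^3\times[0,S)$ with parameter $\varepsilon=\varepsilon_n$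 and initial data $(u_0^{n},\theta_0^{n},p_0^{n})$, $$\bigl\|Pu^{n}(t+h)-Pu^{n}(t)\bigr\|_{L^2([0,T]\times\mathbb{R}^3)}\le C_T\,h^{1/5}.$$ -/

import Mathlib

open MeasureTheory Set Filter Topology
open scoped ENNReal ContDiff

namespace NSF

/-- Physical space `ℝ³`. -/
abbrev Space : Type := EuclideanSpace ℝ (Fin 3)

/-- Square integrable scalar fields, `L²(ℝ³)`. -/
abbrev L2Scal : Type := Lp ℝ 2 (volume : Measure Space)

/-- Square integrable vector fields, `L²(ℝ³)³`. -/
abbrev L2Vec : Type := Lp Space 2 (volume : Measure Space)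

/-- The `i`-th coordinate vector of `ℝ³`. -/
noncomputable def e (i : Fin 3) : Space := EuclideanSpace.single i 1

/-- The gradient fields `∇φ`, `φ ∈ C_c^∞(ℝ³)`, as elements of `L²(ℝ³)³`. -/
def testGradients : Set L2Vec :=
  {g | ∃ φ : Space → ℝ, ContDiff ℝ ∞ φ ∧ HasCompactSupport φ ∧ g =ᵐ[volume] gradient φ}

/-- The closed subspace of the (weakly) divergence free vector fields in `L²(ℝ³)³`: those `v` with
`∫ v · ∇φ = 0` for all `φ ∈ C_c^∞(ℝ³)`. -/
noncomputable def solenoidal : Submodule ℝ L2Vec :=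
  (Submodule.span ℝ testGradients)ᗮ

noncomputable instance : CompleteSpace solenoidal :=
  inferInstanceAs (CompleteSpace ((Submodule.span ℝ testGradients)ᗮ : Submodule ℝ L2Vec))

/-- The Leray projector `P`: the orthogonal projector of `L²(ℝ³)³` onto the space of divergence
free vector fields. -/
noncomputable def lerayP : L2Vec →L[ℝ] L2Vec :=
  solenoidal.starProjection

/-- `g = ∂ᵢ f` in the sense of distributions on `ℝ³`, for scalar or vector fields in `L²`. -/
def HasWeakPartial {F : Type} [NormedAddCommGroup F] [NormedSpace ℝ F] (i : Fin 3)
    (f g : Lp F 2 (volume : Measure Space)) : Prop :=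
  ∀ φ : Space → ℝ, ContDiff ℝ ∞ φ → HasCompactSupport φ →
    ∫ x, (fderiv ℝ φ x (e i)) • f x = -∫ x, φ x • g x

/-- Test functions on `[0, S) × ℝ³`: restrictions to `t ≥ 0` of smooth functions with compact
support in `(-∞, S) × ℝ³`. -/
structure IsTest (S : ℝ) (ψ : ℝ × Space → ℝ) : Prop where
  smooth : ContDiff ℝ ∞ ψ
  compact : HasCompactSupport ψ
  supp : tsupport ψ ⊆ Iio S ×ˢ (univ : Set Space)

/-- The time derivative `∂ₜψ(t, x)`. -/
noncomputable def dt (ψ : ℝ × Space → ℝ) (t : ℝ) (x : Space) : ℝ :=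
  fderiv ℝ ψ (t, x) (1, 0)

/-- The space derivative `∂ⱼψ(t, x)`. -/
noncomputable def dx (j : Fin 3) (ψ : ℝ × Space → ℝ) (t : ℝ) (x : Space) : ℝ :=
  fderiv ℝ ψ (t, x) (0, e j)

/-- `(u, θ, p)` is a (Leray type) weak solution on `ℝ³ × [0, S)`, with initial data `u₀, θ₀, p₀`, of
`∂ₜu + ∇p = Δu - (u · ∇)u - ½ (div u) u`,
`∂ₜθ + u · ∇θ = Δθ - ½ (div u) θ`,
`ε ∂ₜp + div u = 0`,
where `Du j = ∂ⱼu` and `Dθ j = ∂ⱼθ` are the weak space derivatives. -/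
structure IsWeakSolutionWith (S ε : ℝ) (u₀ : L2Vec) (θ₀ p₀ : L2Scal)
    (u : ℝ → L2Vec) (θ p : ℝ → L2Scal)
    (Du : Fin 3 → ℝ → L2Vec) (Dθ : Fin 3 → ℝ → L2Scal) : Prop where
  /-- `u ∈ L^∞([0, S]; L²)`. -/
  u_mem : MemLp u ∞ (volume.restrict (Ioo 0 S))
  /-- `θ ∈ L^∞([0, S]; L²)`. -/
  θ_mem : MemLp θ ∞ (volume.restrict (Ioo 0 S))
  /-- `√ε p ∈ L^∞([0, S]; L²)`. -/
  p_mem : MemLp (fun t => √ε • p t) ∞ (volume.restrict (Ioo 0 S))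
  /-- `∇u ∈ L²([0, S]; L²)`. -/
  Du_mem : ∀ j, MemLp (Du j) 2 (volume.restrict (Ioo 0 S))
  /-- `∇θ ∈ L²([0, S]; L²)`. -/
  Dθ_mem : ∀ j, MemLp (Dθ j) 2 (volume.restrict (Ioo 0 S))
  Du_weak : ∀ j, ∀ᵐ t ∂(volume.restrict (Ioo 0 S)), HasWeakPartial j (u t) (Du j t)
  Dθ_weak : ∀ j, ∀ᵐ t ∂(volume.restrict (Ioo 0 S)), HasWeakPartial j (θ t) (Dθ j t)
  /-- The `i`-th component of the momentum equation, with `u(0) = u₀`. -/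
  momentum : ∀ (i : Fin 3) (ψ : ℝ × Space → ℝ), IsTest S ψ →
    ∫ t in Ioo 0 S, ∫ x,
      (-(u t x i * dt ψ t x) - p t x * dx i ψ t x
        + ∑ j, Du j t x i * dx j ψ t x
        + (∑ j, u t x j * Du j t x i) * ψ (t, x)
        + 1 / 2 * (∑ j, Du j t x j) * u t x i * ψ (t, x))
      = ∫ x, u₀ x i * ψ (0, x)
  /-- The temperature equation, with `θ(0) = θ₀`. -/
  temperature : ∀ ψ : ℝ × Space → ℝ, IsTest S ψ →
    ∫ t in Ioo 0 S, ∫ x,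
      (-(θ t x * dt ψ t x)
        + ∑ j, Dθ j t x * dx j ψ t x
        + (∑ j, u t x j * Dθ j t x) * ψ (t, x)
        + 1 / 2 * (∑ j, Du j t x j) * θ t x * ψ (t, x))
      = ∫ x, θ₀ x * ψ (0, x)
  /-- The pressure equation, with `p(0) = p₀`. -/
  pressure : ∀ ψ : ℝ × Space → ℝ, IsTest S ψ →
    ∫ t in Ioo 0 S, ∫ x,
      (-(ε * p t x * dt ψ t x) + (∑ j, Du j t x j) * ψ (t, x))
      = ∫ x, ε * p₀ x * ψ (0, x)
  /-- The energy inequality. -/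
  energy : ∀ᵐ t ∂(volume.restrict (Ioo 0 S)),
    1 / 2 * ‖u t‖ ^ 2 + 1 / 2 * ‖θ t‖ ^ 2 + ε / 2 * ‖p t‖ ^ 2
        + ∫ s in Ioo 0 t, (∑ j, ‖Du j s‖ ^ 2 + ∑ j, ‖Dθ j s‖ ^ 2)
      ≤ 1 / 2 * ‖u₀‖ ^ 2 + 1 / 2 * ‖θ₀‖ ^ 2 + ε / 2 * ‖p₀‖ ^ 2

/-- `(u, θ, p)` is a weak solution on `ℝ³ × [0, S)` with initial data `u₀, θ₀, p₀`; the weak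
gradients, being unique, are not part of the data. -/
def IsWeakSolution (S ε : ℝ) (u₀ : L2Vec) (θ₀ p₀ : L2Scal)
    (u : ℝ → L2Vec) (θ p : ℝ → L2Scal) : Prop :=
  ∃ Du Dθ, IsWeakSolutionWith S ε u₀ θ₀ p₀ u θ p Du Dθ

/-- The convergence conditions on the initial data `u₀^n, θ₀^n, p₀^n` of the problem with parameter
`ε_n`. -/
structure InitialDataConverge (ε : ℕ → ℝ) (u₀ : ℕ → L2Vec) (θ₀ p₀ : ℕ → L2Scal)
    (u₀lim : L2Vec) (θ₀lim : L2Scal) : Prop where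
  velocity : Tendsto u₀ atTop (𝓝 u₀lim)
  temperature : Tendsto θ₀ atTop (𝓝 θ₀lim)
  pressure : Tendsto (fun n => √(ε n) • p₀ n) atTop (𝓝 0)

end NSF

namespace NSF

/-! Fix `t`, put `z = u(t+h) - u(t)` and `V = Pz`. Since `P` is an orthogonal projector, `‖V‖² = ⟨z,
V⟩`, and `V` is split as `V_a + (V - V_a)` with `V_a` the mollification of `V` at scale `a`.

The remainder `⟨z, V - V_a⟩` is at most a constant times `a ‖∇z‖ ‖z‖`: the gradient known from the
energy is that of `z`, and by duality this is enough (`abs_inner_sub_mollify_le`,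
`norm_sq_le_abs_pair_add`).

For `⟨z, V_a⟩` the momentum equation is integrated over `(t, t+h)` (`sub_shift_eq_integral_of_weak`)
and tested with `V_a`. The pressure is only bounded by a multiple of `ε^{-1/2}`, but it drops out
because `V_a` is divergence free. Diffusion costs `‖∇V_a‖ ≲ a⁻¹ ‖V‖`; the two convective terms cost
`‖V_a‖_∞ ≲ a^{-3/2} ‖V‖`, the price of passing from `L²` to `L^∞` in dimension three
(`abs_sum_momForm_le`, `abs_pair_smooth_sub_le`).

Two points need care. `V_a` is not compactly supported, so it is cut off at radius of order `n`; the
divergence so created is of order `1/n`, and `n → ∞` for fixed `ε` removes the pressure. Moreover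
`V` depends on `t`, while the tested equation holds outside a null set depending on the test field;
separability of `L²` gives one null set for all fields (`ae_abs_pair_le`).

Integrating in `t`, where `∫ ∫_t^{t+h} ‖∇u‖ ≤ h ∫ ‖∇u‖`, bounds the squared norm by a multiple of
`a⁻¹ h + a^{-3/2} h + a` (`lintegral_lerayP_le`). With `a = h^{2/5}` this is of order `h^{2/5}`
(`scale_bound`), and the square root gives `h^{1/5}`. The constants involve only `T`, fixed bump
functions and a bound for the initial energies (`exists_energy_bound`). -/

/-! ### Scalar `L²` norms and components of vector fields -/

/-- The `L²` seminorm of a scalar function, as a real number. -/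
noncomputable def l2 (f : Space → ℝ) : ℝ := (eLpNorm f 2 volume).toReal

lemma l2_nonneg (f : Space → ℝ) : 0 ≤ l2 f := ENNReal.toReal_nonneg

lemma norm_eq_l2 (f : L2Scal) : ‖f‖ = l2 f := rfl

lemma l2_congr {f g : Space → ℝ} (h : f =ᵐ[volume] g) : l2 f = l2 g := by
  rw [l2, l2, eLpNorm_congr_ae h]

lemma l2_abs (f : Space → ℝ) : l2 (fun x => |f x|) = l2 f := by
  have := eLpNorm_norm (p := 2) (μ := (volume : Measure Space)) f
  simp only [Real.norm_eq_abs] at this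
  rw [l2, l2, this]

lemma norm_toLp_eq_l2 {f : Space → ℝ} (hf : MemLp f 2 volume) : ‖hf.toLp f‖ = l2 f :=
  Lp.norm_toLp f hf

lemma inner_eq_integral (f g : L2Scal) : inner ℝ f g = ∫ x, f x * g x := by
  rw [L2.inner_def]
  simp [mul_comm]

lemma integrable_mul_of_memLp {f g : Space → ℝ} (hf : MemLp f 2 volume) (hg : MemLp g 2 volume) :
    Integrable (fun x => f x * g x) volume :=
  hf.integrable_mul hg

lemma abs_integral_mul_le {f g : Space → ℝ} (hf : MemLp f 2 volume) (hg : MemLp g 2 volume) :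
    |∫ x, f x * g x| ≤ l2 f * l2 g := by
  have h := abs_real_inner_le_norm (hf.toLp f) (hg.toLp g)
  rw [inner_eq_integral, norm_toLp_eq_l2, norm_toLp_eq_l2] at h
  convert h using 2
  apply integral_congr_ae
  filter_upwards [hf.coeFn_toLp, hg.coeFn_toLp] with x h1 h2
  rw [h1, h2]

lemma l2_le_of_abs_le {f g : Space → ℝ} (hg : MemLp g 2 volume) (h : ∀ x, |f x| ≤ |g x|) :
    l2 f ≤ l2 g :=
  ENNReal.toReal_mono hg.eLpNorm_ne_top (eLpNorm_mono h)

lemma l2_const_mul (c : ℝ) (f : Space → ℝ) : l2 (fun x => c * f x) = |c| * l2 f := by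
  have : eLpNorm (fun x => c * f x) 2 (volume : Measure Space) = ‖c‖ₑ * eLpNorm f 2 volume :=
    eLpNorm_const_smul c f 2 volume
  rw [l2, this, ENNReal.toReal_mul, l2]
  simp

lemma l2_add_le {f g : Space → ℝ} (hf : MemLp f 2 volume) (hg : MemLp g 2 volume) :
    l2 (fun x => f x + g x) ≤ l2 f + l2 g := by
  have := eLpNorm_add_le hf.1 hg.1 (p := 2) (by norm_num)
  have h2 := ENNReal.toReal_mono
    (ENNReal.add_ne_top.2 ⟨hf.eLpNorm_ne_top, hg.eLpNorm_ne_top⟩) this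
  rwa [ENNReal.toReal_add hf.eLpNorm_ne_top hg.eLpNorm_ne_top] at h2

lemma l2_sq {f : Space → ℝ} (hf : MemLp f 2 volume) : l2 f ^ 2 = ∫ x, f x ^ 2 := by
  have h := real_inner_self_eq_norm_sq (hf.toLp f)
  rw [inner_eq_integral, norm_toLp_eq_l2] at h
  rw [← h]
  apply integral_congr_ae
  filter_upwards [hf.coeFn_toLp] with x h1
  rw [h1, sq]

/-- The `i`-th component of a square integrable vector field. -/
noncomputable def coord (i : Fin 3) : L2Vec →L[ℝ] L2Scal :=
  (EuclideanSpace.proj i : Space →L[ℝ] ℝ).compLpL 2 volume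

lemma coeFn_coord (i : Fin 3) (f : L2Vec) : coord i f =ᵐ[volume] fun x => f x i :=
  ContinuousLinearMap.coeFn_compLpL _ _

lemma norm_coord_le (i : Fin 3) (f : L2Vec) : ‖coord i f‖ ≤ ‖f‖ := by
  apply Lp.norm_le_norm_of_ae_le
  filter_upwards [coeFn_coord i f] with x hx
  rw [hx]
  exact EuclideanSpace.norm_eq (f x) ▸ PiLp.norm_apply_le (f x) i

lemma memLp_coord (i : Fin 3) (f : L2Vec) : MemLp (fun x => f x i) 2 volume :=
  (Lp.memLp (coord i f)).ae_eq (coeFn_coord i f)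

lemma inner_eq_sum_coord (f g : L2Vec) :
    inner ℝ f g = ∑ i, inner ℝ (coord i f) (coord i g) := by
  simp_rw [inner_eq_integral]
  rw [L2.inner_def, ← integral_finsetSum]
  · apply integral_congr_ae
    have h1 : ∀ᵐ x, ∀ i, coord i f x = f x i := ae_all_iff.2 fun i => coeFn_coord i f
    have h2 : ∀ᵐ x, ∀ i, coord i g x = g x i := ae_all_iff.2 fun i => coeFn_coord i g
    filter_upwards [h1, h2] with x h1 h2
    simp [h1, h2, PiLp.inner_apply, mul_comm]
  · intro i _
    exact integrable_mul_of_memLp (Lp.memLp _) (Lp.memLp _)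

/-! ### Convolution as an operator on `L²` -/

/-- The convolution `(k ⋆ f)(x) = ∫ k(x - y) f(y) dy` of scalar functions. -/
noncomputable def conv (k f : Space → ℝ) : Space → ℝ :=
  convolution k f (ContinuousLinearMap.mul ℝ ℝ) volume

lemma conv_apply (k f : Space → ℝ) (x : Space) : conv k f x = ∫ y, k (x - y) * f y :=
  convolution_mul_swap

lemma conv_congr {f g : Space → ℝ} (k : Space → ℝ) (h : f =ᵐ[volume] g) :
    conv k f = conv k g := by
  ext x
  rw [conv_apply, conv_apply]
  apply integral_congr_ae
  filter_upwards [h] with y hy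
  rw [hy]

/-- Cauchy–Schwarz for `f` against `1` in the measure with density `k`. -/
lemma sq_lintegral_mul_le (k f : Space → ℝ≥0∞) (hk : Measurable k) (hf : Measurable f) :
    (∫⁻ y, k y * f y) ^ 2 ≤ (∫⁻ y, k y) * ∫⁻ y, k y * f y ^ 2 := by
  have h := ENNReal.lintegral_mul_le_Lp_mul_Lq (volume.withDensity k) Real.HolderConjugate.two_two
    hf.aemeasurable (aemeasurable_const (b := (1 : ℝ≥0∞)))
  rw [lintegral_withDensity_eq_lintegral_mul _ hk (by fun_prop),
    lintegral_withDensity_eq_lintegral_mul _ hk (by fun_prop),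
    lintegral_withDensity_eq_lintegral_mul _ hk (by fun_prop)] at h
  simp only [Pi.mul_apply, ENNReal.rpow_ofNat, mul_one, one_pow] at h
  calc (∫⁻ y, k y * f y) ^ 2
      ≤ ((∫⁻ y, k y * f y ^ 2) ^ (1 / 2 : ℝ) * (∫⁻ y, k y) ^ (1 / 2 : ℝ)) ^ 2 := by gcongr
    _ = _ := by
        rw [mul_pow, ← ENNReal.rpow_natCast, ← ENNReal.rpow_natCast, ← ENNReal.rpow_mul,
          ← ENNReal.rpow_mul]
        norm_num [mul_comm]

/-- Young's inequality for `L¹ * L²`: Cauchy–Schwarz with weight `|k(x - ·)|`, then Tonelli and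
translation invariance. -/
lemma lintegral_enorm_conv_sq_le {k : Space → ℝ} (hk : Continuous k) (f : L2Scal) :
    ∫⁻ x, ‖conv k f x‖ₑ ^ 2 ≤ (∫⁻ y, ‖k y‖ₑ) ^ 2 * ∫⁻ y, ‖f y‖ₑ ^ 2 := by
  have hf : Measurable (f : Space → ℝ) := (Lp.stronglyMeasurable f).measurable
  have hkm : Measurable k := hk.measurable
  calc ∫⁻ x, ‖conv k f x‖ₑ ^ 2
      ≤ ∫⁻ x, (∫⁻ y, ‖k y‖ₑ) * ∫⁻ y, ‖k (x - y)‖ₑ * ‖f y‖ₑ ^ 2 := by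
        apply lintegral_mono
        intro x
        calc ‖conv k f x‖ₑ ^ 2 ≤ (∫⁻ y, ‖k (x - y)‖ₑ * ‖f y‖ₑ) ^ 2 := by
              gcongr
              rw [conv_apply]
              refine (enorm_integral_le_lintegral_enorm _).trans_eq ?_
              simp [enorm_mul]
          _ ≤ (∫⁻ y, ‖k (x - y)‖ₑ) * ∫⁻ y, ‖k (x - y)‖ₑ * ‖f y‖ₑ ^ 2 :=
              sq_lintegral_mul_le _ _ (by fun_prop) (by fun_prop)
          _ = _ := by
              rw [lintegral_sub_left_eq_self (fun y => ‖k y‖ₑ) x]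
    _ = (∫⁻ y, ‖k y‖ₑ) * ∫⁻ y, ∫⁻ x, ‖k (x - y)‖ₑ * ‖f y‖ₑ ^ 2 := by
        rw [lintegral_const_mul _ (by fun_prop), lintegral_lintegral_swap]
        fun_prop
    _ = _ := by
        rw [sq, mul_assoc]
        congr 1
        rw [← lintegral_const_mul _ (by fun_prop)]
        congr 1 with y
        rw [lintegral_mul_const _ (by fun_prop), lintegral_sub_right_eq_self (fun x => ‖k x‖ₑ) y]

lemma Lp.locallyIntegrable (f : L2Scal) : LocallyIntegrable f (volume : Measure Space) :=
  (Lp.memLp f).locallyIntegrable (by norm_num)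

lemma memLp_conv {k : Space → ℝ} (hk : Continuous k) (hc : HasCompactSupport k) (f : L2Scal) :
    MemLp (conv k f) 2 volume ∧ l2 (conv k f) ≤ (∫ y, |k y|) * ‖f‖ := by
  have hm : AEStronglyMeasurable (conv k f) volume :=
    (hc.continuous_convolution_left _ hk (Lp.locallyIntegrable f)).aestronglyMeasurable
  have hle : eLpNorm (conv k f) 2 volume ≤ (∫⁻ y, ‖k y‖ₑ) * eLpNorm f 2 volume := by
    rw [eLpNorm_eq_lintegral_rpow_enorm_toReal (by norm_num) (by norm_num),
      eLpNorm_eq_lintegral_rpow_enorm_toReal (by norm_num) (by norm_num)]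
    have h := lintegral_enorm_conv_sq_le hk f
    simp only [ENNReal.toReal_ofNat, ENNReal.rpow_ofNat]
    calc _ ≤ ((∫⁻ y, ‖k y‖ₑ) ^ 2 * ∫⁻ y, ‖f y‖ₑ ^ 2) ^ (1 / 2 : ℝ) := by gcongr
      _ = _ := by
        rw [ENNReal.mul_rpow_of_nonneg _ _ (by norm_num), ← ENNReal.rpow_natCast,
          ← ENNReal.rpow_mul]
        norm_num
  have hki : Integrable k volume := hk.integrable_of_hasCompactSupport hc
  have hfin : (∫⁻ y, ‖k y‖ₑ) * eLpNorm f 2 volume ≠ ⊤ :=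
    ENNReal.mul_ne_top hki.2.ne (Lp.eLpNorm_ne_top f)
  refine ⟨⟨hm, hle.trans_lt hfin.lt_top⟩, ?_⟩
  refine (ENNReal.toReal_mono hfin hle).trans_eq ?_
  rw [ENNReal.toReal_mul, norm_eq_l2, l2]
  congr 1
  rw [← integral_toReal (by fun_prop) (by simp)]
  simp

lemma convolutionExistsAt_conv {k : Space → ℝ} (hk : Continuous k) (hc : HasCompactSupport k)
    (f : L2Scal) : ConvolutionExists k f (ContinuousLinearMap.mul ℝ ℝ) volume :=
  hc.convolutionExists_left _ hk (Lp.locallyIntegrable f)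

/-- Convolution with a continuous compactly supported kernel, as an operator on `L²`. -/
noncomputable def mollify (k : Space → ℝ) (hk : Continuous k) (hc : HasCompactSupport k) :
    L2Scal →L[ℝ] L2Scal :=
  LinearMap.mkContinuous
    { toFun := fun f => (memLp_conv hk hc f).1.toLp _
      map_add' := fun f g => by
        rw [← MemLp.toLp_add]
        refine MemLp.toLp_congr _ ((memLp_conv hk hc f).1.add (memLp_conv hk hc g).1) ?_
        refine Eventually.of_forall fun x => ?_
        rw [conv_congr k (Lp.coeFn_add f g)]
        exact (convolutionExistsAt_conv hk hc f x).distrib_add (convolutionExistsAt_conv hk hc g x)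
      map_smul' := fun c f => by
        simp only [RingHom.id_apply]
        rw [← MemLp.toLp_const_smul]
        refine MemLp.toLp_congr _ ((memLp_conv hk hc f).1.const_smul c) ?_
        refine Eventually.of_forall fun x => ?_
        rw [conv_congr k (Lp.coeFn_smul c f)]
        exact congrFun convolution_smul x }
    (∫ y, |k y|) (fun f => by
      change ‖(memLp_conv hk hc f).1.toLp _‖ ≤ _
      rw [norm_toLp_eq_l2]
      exact (memLp_conv hk hc f).2)

lemma coeFn_mollify (k : Space → ℝ) (hk : Continuous k) (hc : HasCompactSupport k) (f : L2Scal) :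
    mollify k hk hc f =ᵐ[volume] conv k f :=
  (memLp_conv hk hc f).1.coeFn_toLp

/-- Cauchy–Schwarz at each point. With the mollification kernel this is the passage from `L²` to
`L^∞` used for the convective terms. -/
lemma abs_conv_le {k : Space → ℝ} (hk : Continuous k) (hc : HasCompactSupport k) (f : L2Scal)
    (x : Space) : |conv k f x| ≤ l2 k * ‖f‖ := by
  have hk2 : MemLp k 2 volume := hk.memLp_of_hasCompactSupport hc
  have hmp : MeasurePreserving (fun y : Space => x - y) volume volume :=
    Measure.measurePreserving_sub_left volume x
  have hk3 : MemLp (fun y => k (x - y)) 2 volume := hk2.comp_measurePreserving hmp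
  rw [conv_apply]
  refine (abs_integral_mul_le hk3 (Lp.memLp f)).trans_eq ?_
  rw [norm_eq_l2]
  congr 1
  rw [l2, l2, ← eLpNorm_comp_measurePreserving hk2.1 hmp]
  rfl

/-! ### The mollification kernel, its scaling and its derivatives -/

/-- A fixed smooth bump function around the origin. -/
noncomputable def baseBump : ContDiffBump (0 : Space) where
  rIn := 1 / 2
  rOut := 1
  rIn_pos := by norm_num
  rIn_lt_rOut := by norm_num

/-- The normalized bump function. -/
noncomputable def bump : Space → ℝ := baseBump.normed volume

lemma contDiff_bump : ContDiff ℝ ∞ bump := baseBump.contDiff_normed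

lemma hasCompactSupport_bump : HasCompactSupport bump := baseBump.hasCompactSupport_normed

/-- The mollification kernel `a⁻³ φ(x / a)`. -/
noncomputable def kernel (a : ℝ) (x : Space) : ℝ := (a ^ 3)⁻¹ * bump (a⁻¹ • x)

lemma contDiff_kernel (a : ℝ) : ContDiff ℝ ∞ (kernel a) :=
  contDiff_const.mul (contDiff_bump.comp (contDiff_id.const_smul a⁻¹))

lemma continuous_kernel (a : ℝ) : Continuous (kernel a) := (contDiff_kernel a).continuous

lemma hasCompactSupport_kernel {a : ℝ} (ha : 0 < a) : HasCompactSupport (kernel a) :=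
  (hasCompactSupport_bump.comp_smul (inv_ne_zero ha.ne')).mul_left

lemma kernel_nonneg {a : ℝ} (ha : 0 < a) (x : Space) : 0 ≤ kernel a x :=
  mul_nonneg (by positivity) (baseBump.nonneg_normed _)

lemma kernel_eq_zero {a : ℝ} (ha : 0 < a) {x : Space} (hx : a ≤ ‖x‖) : kernel a x = 0 := by
  have : a⁻¹ • x ∉ Function.support bump := by
    rw [bump, baseBump.support_normed_eq, Metric.mem_ball, dist_zero_right, norm_smul, not_lt,
      norm_inv, Real.norm_of_nonneg ha.le]
    change 1 ≤ _
    rw [inv_mul_eq_div, one_le_div ha]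
    exact hx
  rw [kernel, Function.notMem_support.1 this, mul_zero]

lemma integral_comp_inv_smul {a : ℝ} (ha : 0 < a) (f : Space → ℝ) :
    ∫ x, f (a⁻¹ • x) = a ^ 3 * ∫ x, f x := by
  rw [Measure.integral_comp_inv_smul_of_nonneg volume f ha.le]
  simp

lemma integral_kernel {a : ℝ} (ha : 0 < a) : ∫ x, kernel a x = 1 := by
  simp only [kernel]
  rw [integral_const_mul, integral_comp_inv_smul ha, bump, baseBump.integral_normed]
  field_simp

lemma integral_abs_kernel {a : ℝ} (ha : 0 < a) : ∫ x, |kernel a x| = 1 := by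
  simp_rw [abs_of_nonneg (kernel_nonneg ha _)]
  exact integral_kernel ha

/-- In the squared norm the prefactor gives `a⁻⁶` and the change of variables `a³`. This exponent is
what limits the final rate. -/
lemma l2_kernel {a : ℝ} (ha : 0 < a) : l2 (kernel a) = a ^ (-(3 / 2) : ℝ) * l2 bump := by
  have hk : MemLp (kernel a) 2 volume :=
    (continuous_kernel a).memLp_of_hasCompactSupport (hasCompactSupport_kernel ha)
  have hb : MemLp bump 2 volume :=
    contDiff_bump.continuous.memLp_of_hasCompactSupport hasCompactSupport_bump
  rw [← sq_eq_sq₀ (l2_nonneg _) (mul_nonneg (by positivity) (l2_nonneg _)), mul_pow, l2_sq hk,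
    l2_sq hb]
  simp only [kernel, mul_pow]
  rw [integral_const_mul, integral_comp_inv_smul ha (fun x => bump x ^ 2), ← mul_assoc]
  congr 1
  rw [← Real.rpow_natCast (a ^ (-(3 / 2) : ℝ)), ← Real.rpow_mul ha.le]
  have : (-(3 / 2) * (2 : ℕ) : ℝ) = -((3 : ℕ) : ℝ) := by norm_num
  rw [this, Real.rpow_neg ha.le, Real.rpow_natCast]
  field_simp

lemma fderiv_kernel (a : ℝ) (x y : Space) :
    fderiv ℝ (kernel a) x y = (a ^ 3)⁻¹ * (a⁻¹ * fderiv ℝ bump (a⁻¹ • x) y) := by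
  have hb : HasFDerivAt bump (fderiv ℝ bump (a⁻¹ • x)) (a⁻¹ • x) :=
    (contDiff_bump.differentiable (by simp)).differentiableAt.hasFDerivAt
  have h1 : HasFDerivAt (fun x : Space => a⁻¹ • x) (a⁻¹ • ContinuousLinearMap.id ℝ Space) x :=
    (hasFDerivAt_id x).const_smul a⁻¹
  have := ((hb.comp x h1).const_mul ((a ^ 3)⁻¹)).fderiv
  have h2 : fderiv ℝ (kernel a) x = _ := this
  rw [h2]
  simp

/-- The `L¹` norm of the kernel is scale invariant, so a derivative costs exactly one factor `a⁻¹`.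
-/
lemma integral_abs_fderiv_kernel {a : ℝ} (ha : 0 < a) (y : Space) :
    ∫ x, |fderiv ℝ (kernel a) x y| = a⁻¹ * ∫ x, |fderiv ℝ bump x y| := by
  simp_rw [fderiv_kernel, abs_mul]
  rw [integral_const_mul, integral_const_mul, integral_comp_inv_smul ha
    (fun x => |fderiv ℝ bump x y|), abs_of_pos (by positivity), abs_of_pos (by positivity)]
  field_simp

/-- A derivative of a smooth compactly supported function in a fixed direction. -/
lemma contDiff_fderiv_apply {E : Type*} [NormedAddCommGroup E] [NormedSpace ℝ E] {f : E → ℝ}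
    (hf : ContDiff ℝ ∞ f) (y : E) : ContDiff ℝ ∞ (fun x => fderiv ℝ f x y) :=
  (hf.fderiv_right (m := ∞) (by simp)).clm_apply contDiff_const

lemma hasCompactSupport_fderiv_apply {E : Type*} [NormedAddCommGroup E] [NormedSpace ℝ E]
    {f : E → ℝ} (hf : HasCompactSupport f) (y : E) :
    HasCompactSupport (fun x => fderiv ℝ f x y) :=
  hf.fderiv_apply ℝ y

lemma contDiff_conv {k : Space → ℝ} (hk : ContDiff ℝ ∞ k) (hc : HasCompactSupport k)
    (f : L2Scal) : ContDiff ℝ ∞ (conv k f) :=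
  hc.contDiff_convolution_left _ hk (Lp.locallyIntegrable f)

lemma fderiv_conv {k : Space → ℝ} (hk : ContDiff ℝ ∞ k) (hc : HasCompactSupport k)
    (f : L2Scal) (x y : Space) :
    fderiv ℝ (conv k f) x y = conv (fun x => fderiv ℝ k x y) f x := by
  have h := (hc.hasFDerivAt_convolution_left (ContinuousLinearMap.mul ℝ ℝ)
    (hk.of_le (by simp)) (Lp.locallyIntegrable f) x).fderiv
  have h2 : fderiv ℝ (conv k f) x = _ := h
  rw [h2, conv, convolution, convolution, ContinuousLinearMap.integral_apply]
  · rfl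
  · exact (hc.fderiv ℝ).convolutionExists_left _ (hk.continuous_fderiv (by simp))
      (Lp.locallyIntegrable f) x

lemma hasWeakPartial_coord {j : Fin 3} {f g : L2Vec} (h : HasWeakPartial j f g) (i : Fin 3) :
    HasWeakPartial j (coord i f) (coord i g) := by
  intro φ hφ hc
  have hφ' := contDiff_fderiv_apply hφ (e j)
  have hc' := hasCompactSupport_fderiv_apply hc (e j)
  have key : ∀ (k : Space → ℝ) (v : L2Vec), ContDiff ℝ ∞ k → HasCompactSupport k →
      ∫ x, k x • coord i v x = (∫ x, k x • v x) i := by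
    intro k v hk hkc
    have h1 : ∫ x, k x • coord i v x
        = ∫ x, (EuclideanSpace.proj i : Space →L[ℝ] ℝ) (k x • v x) := by
      apply integral_congr_ae
      filter_upwards [coeFn_coord i v] with x hx
      rw [hx]
      simp
    rw [h1, ContinuousLinearMap.integral_comp_comm]
    · rfl
    · exact ((Lp.memLp v).locallyIntegrable (by norm_num)).integrable_smul_left_of_hasCompactSupport
        hk.continuous hkc
  rw [key _ f hφ' hc', key _ g hφ hc, h φ hφ hc]
  rfl

/-! ### The commutator estimate -/

/-- The translated test function `x ↦ v(x - y)`. -/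
lemma hasCompactSupport_comp_sub {v : Space → ℝ} (hc : HasCompactSupport v) (y : Space) :
    HasCompactSupport (fun x => v (x - y)) :=
  hc.comp_homeomorph (Homeomorph.subRight y)

lemma l2_comp_sub {v : Space → ℝ} (hv : Continuous v) (y : Space) :
    l2 (fun x => v (x - y)) = l2 v := by
  rw [l2, l2, ← eLpNorm_comp_measurePreserving hv.aestronglyMeasurable
    (measurePreserving_sub_right volume y)]
  rfl

/-- The correlation `y ↦ ∫ z(x) v(x - y) dx` of `z ∈ L²` and a test function. -/
noncomputable def corr (z : L2Scal) (v : Space → ℝ) (y : Space) : ℝ := ∫ x, z x * v (x - y)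

lemma corr_eq_convolution (z : L2Scal) (v : Space → ℝ) :
    corr z v = convolution z (fun x => v (-x)) (ContinuousLinearMap.mul ℝ ℝ) volume := by
  ext y
  rw [convolution_mul, corr]
  simp

lemma hasFDerivAt_corr (z : L2Scal) {v : Space → ℝ} (hv : ContDiff ℝ ∞ v)
    (hc : HasCompactSupport v) (y : Space) :
    ∃ L : Space →L[ℝ] ℝ, HasFDerivAt (corr z v) L y ∧
      ∀ w, L w = -∫ x, z x * fderiv ℝ v (x - y) w := by
  have hc' : HasCompactSupport (fun x => v (-x)) := hc.comp_homeomorph (Homeomorph.neg Space)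
  have hv' : ContDiff ℝ ∞ (fun x => v (-x)) := hv.comp contDiff_neg
  have h := hc'.hasFDerivAt_convolution_right (ContinuousLinearMap.mul ℝ ℝ)
    (Lp.locallyIntegrable z) (hv'.of_le (by simp)) y
  rw [← corr_eq_convolution] at h
  refine ⟨_, h, fun w => ?_⟩
  rw [convolution, ContinuousLinearMap.integral_apply, ← integral_neg]
  · congr 1 with x
    have h1 : HasFDerivAt v (fderiv ℝ v (-(y - x))) (-(y - x)) :=
      (hv.differentiable (by simp)).differentiableAt.hasFDerivAt
    have h2 := (h1.comp (y - x) (hasFDerivAt_id (y - x)).neg).fderiv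
    have h3 : fderiv ℝ (fun x => v (-x)) (y - x) = _ := h2
    simp [ContinuousLinearMap.precompR_apply, h3]
  · exact (hc'.fderiv ℝ).convolutionExists_right _ (Lp.locallyIntegrable z)
      (hv'.continuous_fderiv (by simp)) y

lemma sum_smul_e (w : Space) : ∑ j, w j • e j = w := by
  ext i
  simp [e, Fin.sum_univ_three]
  fin_cases i <;> simp

/-- A translate of `v` is again a test function, so the weak derivative can be moved from `v` to
`z`, one coordinate of `w` at a time. -/
lemma norm_fderiv_corr_le {z : L2Scal} {d : Fin 3 → L2Scal} (hd : ∀ j, HasWeakPartial j z (d j))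
    {v : Space → ℝ} (hv : ContDiff ℝ ∞ v) (hc : HasCompactSupport v) (y w : Space) :
    |∫ x, z x * fderiv ℝ v (x - y) w| ≤ ‖w‖ * ((∑ j, ‖d j‖) * l2 v) := by
  have hcy := hasCompactSupport_comp_sub hc y
  have hvy : ContDiff ℝ ∞ (fun x => v (x - y)) := hv.comp (contDiff_id.sub contDiff_const)
  have hfd : ∀ x j, fderiv ℝ (fun x => v (x - y)) x (e j) = fderiv ℝ v (x - y) (e j) := by
    intro x j
    rw [fderiv_comp_sub]
  have hexp : ∀ x, z x * fderiv ℝ v (x - y) w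
      = ∑ j, w j * (fderiv ℝ (fun x => v (x - y)) x (e j) • z x) := by
    intro x
    conv_lhs => rw [← sum_smul_e w]
    rw [map_sum, Finset.mul_sum]
    refine Finset.sum_congr rfl fun j _ => ?_
    rw [hfd, map_smul, smul_eq_mul, smul_eq_mul]
    ring
  simp_rw [hexp]
  rw [integral_finsetSum]
  · have hj : ∀ j, |∫ x, w j * (fderiv ℝ (fun x => v (x - y)) x (e j) • z x)|
        ≤ ‖w‖ * (‖d j‖ * l2 v) := by
      intro j
      rw [integral_const_mul, hd j _ hvy hcy, abs_mul, abs_neg]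
      have h1 := abs_integral_mul_le (hvy.continuous.memLp_of_hasCompactSupport (p := 2)
        (μ := volume) hcy) (Lp.memLp (d j))
      rw [l2_comp_sub hv.continuous, mul_comm, ← norm_eq_l2] at h1
      have h2 : |w j| ≤ ‖w‖ := PiLp.norm_apply_le w j
      have h3 := mul_le_mul h2 h1 (abs_nonneg _) (norm_nonneg _)
      simpa only [smul_eq_mul] using (by simpa [mul_comm] using h3)
    calc _ ≤ ∑ j, |∫ x, w j * (fderiv ℝ (fun x => v (x - y)) x (e j) • z x)| :=
          Finset.abs_sum_le_sum_abs _ _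
      _ ≤ ∑ j, ‖w‖ * (‖d j‖ * l2 v) := Finset.sum_le_sum fun j _ => hj j
      _ = _ := by rw [Finset.sum_mul, Finset.mul_sum]
  · intro j _
    exact ((Lp.locallyIntegrable z).integrable_smul_left_of_hasCompactSupport
      (contDiff_fderiv_apply hvy (e j)).continuous
      (hasCompactSupport_fderiv_apply hcy (e j))).const_mul _

/-- The mean value inequality: the correlation is Lipschitz with a constant that involves `∇z` but
only the `L²` norm of `v`. This is why no derivative of `v` enters the commutator estimate. -/
lemma abs_corr_sub_le {z : L2Scal} {d : Fin 3 → L2Scal} (hd : ∀ j, HasWeakPartial j z (d j))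
    {v : Space → ℝ} (hv : ContDiff ℝ ∞ v) (hc : HasCompactSupport v) (y : Space) :
    |corr z v y - corr z v 0| ≤ (∑ j, ‖d j‖) * l2 v * ‖y‖ := by
  have hK : 0 ≤ (∑ j, ‖d j‖) * l2 v :=
    mul_nonneg (Finset.sum_nonneg fun j _ => norm_nonneg _) (l2_nonneg _)
  choose L hL hL' using fun y => hasFDerivAt_corr z hv hc y
  have := convex_univ.norm_image_sub_le_of_norm_hasFDerivWithin_le (f := corr z v) (f' := L)
    (C := (∑ j, ‖d j‖) * l2 v) (fun x _ => (hL x).hasFDerivWithinAt)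
    (fun x _ => ContinuousLinearMap.opNorm_le_bound _ hK fun w => by
      rw [hL', Real.norm_eq_abs, abs_neg, mul_comm]
      exact norm_fderiv_corr_le hd hv hc x w)
    (mem_univ 0) (mem_univ y)
  simpa using this

lemma integral_mul_conv_eq {k : Space → ℝ} (hk : Continuous k) (hc : HasCompactSupport k)
    (z : L2Scal) {v : Space → ℝ} (hv : Continuous v) (hvc : HasCompactSupport v) :
    ∫ x, z x * conv k v x = ∫ y, k y * corr z v y := by
  obtain ⟨M, hM⟩ := hv.bounded_above_of_compact_support hvc
  simp_rw [conv, convolution_mul, corr, ← integral_const_mul]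
  rw [integral_integral_swap]
  · congr 1 with y
    congr 1 with x
    ring
  -- `z` is only locally integrable. Nonzero integrands force `x` into the sum of the two compact
  -- supports, so `z` may be cut down to that set for the Fubini domination.
  · obtain ⟨K, hK, hKe⟩ : ∃ K : Set Space, IsCompact K ∧ ∀ x y, x ∉ K → k y * v (x - y) = 0 := by
      refine ⟨_, hvc.isCompact.add hc.isCompact, fun x y hx => ?_⟩
      by_contra hne
      apply hx
      have h1 : v (x - y) ≠ 0 := right_ne_zero_of_mul hne
      have h2 : k y ≠ 0 := left_ne_zero_of_mul hne
      exact ⟨x - y, subset_tsupport _ h1, y, subset_tsupport _ h2, by simp⟩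
    have hzi : Integrable (K.indicator z) volume :=
      ((Lp.locallyIntegrable z).integrableOn_isCompact hK).integrable_indicator hK.measurableSet
    have hki : Integrable k volume := hk.integrable_of_hasCompactSupport hc
    refine ((hzi.mul_prod hki).mul_const M).mono ?_ ?_
    · have hz : AEStronglyMeasurable (fun p : Space × Space => z p.1)
          ((volume : Measure Space).prod volume) :=
        ((Lp.stronglyMeasurable z).comp_measurable measurable_fst).aestronglyMeasurable
      exact hz.mul (by fun_prop : Continuous fun p : Space × Space =>
        k p.2 * v (p.1 - p.2)).aestronglyMeasurable
    · refine Eventually.of_forall fun p => ?_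
      by_cases hp : p.1 ∈ K
      · simp only [Function.uncurry, Set.indicator_of_mem hp, norm_mul, ← mul_assoc]
        have : ‖v (p.1 - p.2)‖ ≤ ‖M‖ := (hM _).trans (le_abs_self _)
        gcongr
      · simp only [Function.uncurry, hKe p.1 p.2 hp, mul_zero, norm_zero]
        positivity

lemma inner_mollify_sub_le_of_smooth {a : ℝ} (ha : 0 < a) {z : L2Scal} {d : Fin 3 → L2Scal}
    (hd : ∀ j, HasWeakPartial j z (d j)) {v : Space → ℝ} (hv : ContDiff ℝ ∞ v)
    (hc : HasCompactSupport v) :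
    |(∫ x, z x * v x) - ∫ x, z x * conv (kernel a) v x| ≤ a * ((∑ j, ‖d j‖) * l2 v) := by
  have hK : 0 ≤ (∑ j, ‖d j‖) * l2 v :=
    mul_nonneg (Finset.sum_nonneg fun j _ => norm_nonneg _) (l2_nonneg _)
  have hcont : Continuous (corr z v) := by
    choose L hL _ using fun y => hasFDerivAt_corr z hv hc y
    exact continuous_iff_continuousAt.2 fun y => (hL y).continuousAt
  have hkc := continuous_kernel a
  have hks := hasCompactSupport_kernel ha
  have hki : Integrable (kernel a) volume := hkc.integrable_of_hasCompactSupport hks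
  have hint : Integrable (fun y => kernel a y * corr z v y) volume :=
    (hkc.mul hcont).integrable_of_hasCompactSupport hks.mul_right
  -- The kernel has mass one, so the unmollified pairing becomes an integral against the same
  -- kernel. Only increments of the correlation over distances less than `a` remain.
  have h0 : ∫ x, z x * v x = ∫ y, kernel a y * corr z v 0 := by
    rw [integral_mul_const, integral_kernel ha, one_mul, corr]
    simp
  rw [integral_mul_conv_eq hkc hks z hv.continuous hc, h0,
    ← integral_sub (hki.mul_const _) hint]
  calc |∫ y, (kernel a y * corr z v 0 - kernel a y * corr z v y)|
      ≤ ∫ y, kernel a y * (a * ((∑ j, ‖d j‖) * l2 v)) := by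
        rw [← Real.norm_eq_abs]
        refine norm_integral_le_of_norm_le (hki.mul_const _) (Eventually.of_forall fun y => ?_)
        rw [← mul_sub, Real.norm_eq_abs, abs_mul, abs_of_nonneg (kernel_nonneg ha y)]
        rcases le_or_gt a ‖y‖ with h | h
        · simp [kernel_eq_zero ha h]
        · refine mul_le_mul_of_nonneg_left ?_ (kernel_nonneg ha y)
          rw [abs_sub_comm]
          refine (abs_corr_sub_le hd hv hc y).trans ?_
          rw [mul_comm]
          exact mul_le_mul_of_nonneg_right h.le hK
    _ = _ := by rw [integral_mul_const, integral_kernel ha, one_mul]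

/-- The commutator estimate `|⟨z, v - φₐ ⋆ v⟩| ≤ a ‖∇z‖ ‖v‖`. -/
lemma abs_inner_sub_mollify_le {a : ℝ} (ha : 0 < a) {z : L2Scal} {d : Fin 3 → L2Scal}
    (hd : ∀ j, HasWeakPartial j z (d j)) (v : L2Scal) :
    |inner ℝ z (v - mollify (kernel a) (continuous_kernel a) (hasCompactSupport_kernel ha) v)|
      ≤ a * ((∑ j, ‖d j‖) * ‖v‖) := by
  set J := mollify (kernel a) (continuous_kernel a) (hasCompactSupport_kernel ha)
  -- Both sides are continuous in `v`, so smooth compactly supported `v`, which are dense in `L²`,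
  -- suffice.
  have hcl : IsClosed {v : L2Scal | |inner ℝ z (v - J v)| ≤ a * ((∑ j, ‖d j‖) * ‖v‖)} :=
    isClosed_le (by fun_prop) (by fun_prop)
  have hsub : {v : L2Scal | ∃ g : Space → ℝ, v =ᵐ[volume] g ∧ HasCompactSupport g ∧
      ContDiff ℝ ∞ g} ⊆ {v : L2Scal | |inner ℝ z (v - J v)| ≤ a * ((∑ j, ‖d j‖) * ‖v‖)} := by
    rintro v ⟨g, hvg, hgc, hg⟩
    have h := inner_mollify_sub_le_of_smooth ha hd hg hgc
    rw [← l2_congr hvg, ← norm_eq_l2] at h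
    rw [mem_ofPred_eq, inner_sub_right, inner_eq_integral, inner_eq_integral]
    convert h using 3
    · apply integral_congr_ae
      filter_upwards [hvg] with x hx
      rw [hx]
    · apply integral_congr_ae
      filter_upwards [coeFn_mollify (kernel a) (continuous_kernel a)
        (hasCompactSupport_kernel ha) v] with x hx
      rw [hx, conv_congr _ hvg]
  exact hcl.closure_subset_iff.2 hsub (Lp.dense_hasCompactSupport_contDiff (by norm_num) v)

/-! ### Time increments from a weak equation -/

/-- Fubini on the strip `s - h < t ≤ s`. It serves both to identify time increments and to integrate
the final estimate in time. -/
lemma integral_mul_window_eq {ζ B : ℝ → ℝ} (hζ : Integrable ζ) (hB : Integrable B) {h : ℝ}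
    (hh : 0 < h) :
    ∫ s, (∫ t in (s - h)..s, ζ t) * B s = ∫ t, ζ t * ∫ s in t..(t + h), B s := by
  have h1 : ∀ s, (∫ t in (s - h)..s, ζ t) * B s
      = ∫ t, {p : ℝ × ℝ | p.1 - h < p.2 ∧ p.2 ≤ p.1}.indicator
        (fun p : ℝ × ℝ => B p.1 * ζ p.2) (s, t) := by
    intro s
    rw [intervalIntegral.integral_of_le (by linarith), ← integral_indicator measurableSet_Ioc,
      ← integral_mul_const]
    congr 1 with t
    by_cases ht : t ∈ Ioc (s - h) s
    · rw [indicator_of_mem ht, indicator_of_mem (by exact ht), mul_comm]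
    · rw [indicator_of_notMem ht, indicator_of_notMem (by exact ht), zero_mul]
  have h2 : ∀ t, ζ t * ∫ s in t..(t + h), B s
      = ∫ s, {p : ℝ × ℝ | p.1 - h < p.2 ∧ p.2 ≤ p.1}.indicator
        (fun p : ℝ × ℝ => B p.1 * ζ p.2) (s, t) := by
    intro t
    -- For fixed `t` the strip is `t ≤ s < t + h`, half-open on the other side from the interval
    -- integral; the endpoints have measure zero.
    rw [intervalIntegral.integral_of_le (by linarith), integral_Ioc_eq_integral_Ioo,
      ← integral_Ico_eq_integral_Ioo, ← integral_indicator measurableSet_Ico,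
      ← integral_const_mul]
    congr 1 with s
    have hiff : s ∈ Ico t (t + h) ↔ (s, t) ∈ {p : ℝ × ℝ | p.1 - h < p.2 ∧ p.2 ≤ p.1} := by
      simp only [mem_Ico, mem_ofPred_eq, sub_lt_iff_lt_add]
      tauto
    by_cases ht : s ∈ Ico t (t + h)
    · rw [indicator_of_mem ht, indicator_of_mem (hiff.1 ht), mul_comm]
    · rw [indicator_of_notMem ht, indicator_of_notMem (fun h => ht (hiff.2 h)), mul_zero]
  simp_rw [h1, h2]
  rw [integral_integral_swap]
  refine (hB.mul_prod hζ).indicator ?_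
  exact (measurableSet_lt (f := fun p : ℝ × ℝ => p.1 - h) (g := fun p : ℝ × ℝ => p.2)
    (by fun_prop) (by fun_prop)).inter (measurableSet_le (f := fun p : ℝ × ℝ => p.2)
    (g := fun p : ℝ × ℝ => p.1) (by fun_prop) (by fun_prop))

/-- The moving average of a smooth function over a window of length `h`. -/
lemma hasDerivAt_window {ζ : ℝ → ℝ} (hζ : Continuous ζ) (h s : ℝ) :
    HasDerivAt (fun s => ∫ t in (s - h)..s, ζ t) (ζ s - ζ (s - h)) s := by
  have h1 : (fun s => ∫ t in (s - h)..s, ζ t)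
      = fun s => (∫ t in (0 : ℝ)..s, ζ t) - ∫ t in (0 : ℝ)..(s - h), ζ t := by
    ext s
    rw [intervalIntegral.integral_interval_sub_left (hζ.intervalIntegrable _ _)
      (hζ.intervalIntegrable _ _)]
  rw [h1]
  have hF : ∀ s, HasDerivAt (fun s => ∫ t in (0 : ℝ)..s, ζ t) (ζ s) s := fun s =>
    hζ.integral_hasStrictDerivAt 0 s |>.hasDerivAt
  exact (hF s).sub ((hF (s - h)).comp_sub_const s h)

lemma contDiff_window {ζ : ℝ → ℝ} (hζ : ContDiff ℝ ∞ ζ) (h : ℝ) :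
    ContDiff ℝ ∞ (fun s => ∫ t in (s - h)..s, ζ t) := by
  rw [contDiff_infty_iff_deriv]
  refine ⟨fun s => (hasDerivAt_window hζ.continuous h s).differentiableAt, ?_⟩
  have : deriv (fun s => ∫ t in (s - h)..s, ζ t) = fun s => ζ s - ζ (s - h) := by
    ext s
    exact (hasDerivAt_window hζ.continuous h s).deriv
  rw [this]
  exact hζ.sub (hζ.comp (contDiff_id.sub contDiff_const))

lemma support_window_subset {ζ : ℝ → ℝ} {c d h : ℝ} (hh : 0 < h)
    (hs : Function.support ζ ⊆ Icc c d) :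
    Function.support (fun s => ∫ t in (s - h)..s, ζ t) ⊆ Icc c (d + h) := by
  intro s hne
  by_contra hn
  apply hne
  simp only
  rw [intervalIntegral.integral_of_le (by linarith)]
  refine setIntegral_eq_zero_of_forall_eq_zero fun t ht => ?_
  by_contra h0
  have h1 := hs h0
  exact hn ⟨h1.1.trans ht.2, by linarith [h1.2, ht.1]⟩

/-- If `a' + b = 0` weakly on `(0, S)`, then `a(t) - a(t + h) = ∫ b` over `(t, t + h)`. -/
lemma sub_shift_eq_integral_of_weak {S h : ℝ} (hh : 0 < h) {a b : ℝ → ℝ}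
    (ha : IntegrableOn a (Ioo 0 S)) (hb : IntegrableOn b (Ioo 0 S))
    (hab : ∀ η : ℝ → ℝ, ContDiff ℝ ∞ η → HasCompactSupport η → tsupport η ⊆ Ioo 0 S →
      ∫ t in Ioo 0 S, (-(deriv η t * a t) + η t * b t) = 0) :
    ∀ᵐ t, t ∈ Ioo 0 (S - h) → a (t + h) - a t = -∫ s in Ioo t (t + h), b s := by
  set A := (Ioo 0 S).indicator a with hA
  set B := (Ioo 0 S).indicator b with hB
  have hAi : Integrable A := ha.integrable_indicator measurableSet_Ioo
  have hBi : Integrable B := hb.integrable_indicator measurableSet_Ioo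
  have hAh : Integrable (fun t => A (t + h)) := hAi.comp_add_right h
  have hW : Continuous (fun t => ∫ s in t..(t + h), B s) := by
    have : (fun t => ∫ s in t..(t + h), B s)
        = fun t => (∫ s in (0 : ℝ)..(t + h), B s) - ∫ s in (0 : ℝ)..t, B s := by
      ext t
      rw [intervalIntegral.integral_interval_sub_left hBi.intervalIntegrable
        hBi.intervalIntegrable]
    rw [this]
    have hc := intervalIntegral.continuous_primitive (fun _ _ => hBi.intervalIntegrable) (0 : ℝ)
    exact (hc.comp (continuous_id.add continuous_const)).sub hc
  have hG : LocallyIntegrable (fun t => A t - A (t + h) - ∫ s in t..(t + h), B s) :=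
    (hAi.sub hAh).locallyIntegrable.sub hW.locallyIntegrable
  have key := isOpen_Ioo (a := (0 : ℝ)) (b := S - h) |>.ae_eq_zero_of_integral_contDiff_smul_eq_zero
    (hG.locallyIntegrableOn _) ?_
  · filter_upwards [key] with t ht htm
    have h0 := ht htm
    have h1 : A t = a t := indicator_of_mem (s := Ioo 0 S) ⟨htm.1, by linarith [htm.2]⟩ _
    have h2 : A (t + h) = a (t + h) :=
      indicator_of_mem (s := Ioo 0 S) ⟨by linarith [htm.1], by linarith [htm.2]⟩ _
    have h3 : ∫ s in t..(t + h), B s = ∫ s in Ioo t (t + h), b s := by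
      rw [intervalIntegral.integral_of_le (by linarith), integral_Ioc_eq_integral_Ioo]
      refine setIntegral_congr_fun measurableSet_Ioo fun s hs => ?_
      exact indicator_of_mem (s := Ioo 0 S) ⟨by linarith [hs.1, htm.1], by linarith [hs.2, htm.2]⟩ _
    rw [h1, h2, h3] at h0
    linarith
  · intro ζ hζ hζc hζs
    obtain ⟨c, d, hc, hd, hcd⟩ : ∃ c d, 0 < c ∧ d < S - h ∧ Function.support ζ ⊆ Icc c d := by
      rcases (tsupport ζ).eq_empty_or_nonempty with he | hne
      -- The support is empty here, so only the two strict inequalities matter.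
      · refine ⟨1, S - h - 1, by norm_num, by linarith, ?_⟩
        exact (subset_tsupport ζ).trans (he ▸ empty_subset _)
      · obtain ⟨c, hc, hc'⟩ := hζc.isCompact.exists_isLeast hne
        obtain ⟨d, hd, hd'⟩ := hζc.isCompact.exists_isGreatest hne
        exact ⟨c, d, (hζs hc).1, (hζs hd).2, fun t ht =>
          ⟨hc' (subset_tsupport _ ht), hd' (subset_tsupport _ ht)⟩⟩
    have hζi : Integrable ζ := hζ.continuous.integrable_of_hasCompactSupport hζc
    -- The moving average is the right test function because its derivative is `ζ(s) - ζ(s - h)`: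
    -- after a shift, the weak equation becomes a statement about `a(t) - a(t + h)` tested with `ζ`.
    set η : ℝ → ℝ := fun s => ∫ t in (s - h)..s, ζ t with hη
    have hηs : tsupport η ⊆ Icc c (d + h) :=
      closure_minimal (support_window_subset hh hcd) isClosed_Icc
    have hηd : ContDiff ℝ ∞ η := contDiff_window hζ h
    have hηc : HasCompactSupport η := HasCompactSupport.intro isCompact_Icc fun x hx => by
      by_contra h0
      exact hx (hηs (subset_tsupport _ h0))
    have hw := hab η hηd hηc (hηs.trans fun t ht => ⟨by linarith [ht.1], by linarith [ht.2]⟩)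
    have hder : ∀ t, deriv η t = ζ t - ζ (t - h) := fun t =>
      (hasDerivAt_window hζ.continuous h t).deriv
    obtain ⟨M, hM⟩ := hζ.continuous.bounded_above_of_compact_support hζc
    obtain ⟨N, hN⟩ := hηd.continuous.bounded_above_of_compact_support hηc
    have hi1 : Integrable (fun t => ζ t * A t) :=
      hAi.bdd_mul hζ.continuous.aestronglyMeasurable (Eventually.of_forall hM)
    have hi2 : Integrable (fun t => ζ (t - h) * A t) :=
      hAi.bdd_mul (hζ.continuous.comp (by fun_prop)).aestronglyMeasurable
        (Eventually.of_forall fun t => hM _)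
    have hi2' : Integrable (fun t => ζ t * A (t + h)) :=
      hAh.bdd_mul hζ.continuous.aestronglyMeasurable (Eventually.of_forall hM)
    have hi3 : Integrable (fun t => η t * B t) :=
      hBi.bdd_mul hηd.continuous.aestronglyMeasurable (Eventually.of_forall hN)
    have hi4 : Integrable (fun t => ζ t * ∫ s in t..(t + h), B s) :=
      (hζ.continuous.mul hW).integrable_of_hasCompactSupport hζc.mul_right
    have e1 : ∫ t, (-(ζ t * A t) + ζ (t - h) * A t + η t * B t) = 0 := by
      rw [← hw, ← integral_indicator measurableSet_Ioo]
      congr 1 with t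
      by_cases ht : t ∈ Ioo 0 S
      · rw [indicator_of_mem ht, hA, hB, indicator_of_mem ht, indicator_of_mem ht, hder]
        ring
      · rw [indicator_of_notMem ht, hA, hB, indicator_of_notMem ht, indicator_of_notMem ht]
        ring
    have hi5 : Integrable (fun t => -(ζ t * A t)) := hi1.neg
    have hi6 : Integrable (fun t => -(ζ t * A t) + ζ (t - h) * A t) := hi5.add hi2
    have hi7 : Integrable (fun t => ζ t * A t - ζ t * A (t + h)) := hi1.sub hi2'
    rw [integral_add hi6 hi3, integral_add hi5 hi2, integral_neg,
      integral_mul_window_eq hζi hBi hh] at e1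
    have e2 : ∫ t, ζ (t - h) * A t = ∫ t, ζ t * A (t + h) := by
      rw [← integral_add_right_eq_self (fun t => ζ (t - h) * A t) h]
      simp
    simp only [smul_eq_mul, mul_sub]
    rw [integral_sub hi7 hi4, integral_sub hi1 hi2']
    linarith

/-! ### The momentum equation as pairings in `L²` -/

/-- `f` is integrable on `ℝ³` with integral `c`. -/
def HasInt (f : Space → ℝ) (c : ℝ) : Prop := Integrable f volume ∧ ∫ x, f x = c

namespace HasInt

variable {f g : Space → ℝ} {c d : ℝ}

lemma add (hf : HasInt f c) (hg : HasInt g d) : HasInt (fun x => f x + g x) (c + d) :=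
  ⟨hf.1.add hg.1, by rw [integral_add hf.1 hg.1, hf.2, hg.2]⟩

lemma neg (hf : HasInt f c) : HasInt (fun x => -f x) (-c) :=
  ⟨hf.1.neg, by rw [integral_neg, hf.2]⟩

lemma const_mul (r : ℝ) (hf : HasInt f c) : HasInt (fun x => r * f x) (r * c) :=
  ⟨hf.1.const_mul r, by rw [integral_const_mul, hf.2]⟩

lemma sum {F : Fin 3 → Space → ℝ} {C : Fin 3 → ℝ} (h : ∀ j, HasInt (F j) (C j)) :
    HasInt (fun x => ∑ j, F j x) (∑ j, C j) :=
  ⟨integrable_finsetSum _ fun j _ => (h j).1, by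
    rw [integral_finsetSum _ fun j _ => (h j).1]
    exact Finset.sum_congr rfl fun j _ => (h j).2⟩

lemma congr (hf : HasInt f c) (h : f =ᵐ[volume] g) : HasInt g c :=
  ⟨hf.1.congr h, by rw [← integral_congr_ae h, hf.2]⟩

lemma inner (f g : L2Scal) : HasInt (fun x => f x * g x) (inner ℝ f g) :=
  ⟨integrable_mul_of_memLp (Lp.memLp f) (Lp.memLp g), (inner_eq_integral f g).symm⟩

end HasInt

lemma memLp_mul_test {m : Space → ℝ} (hm : Continuous m) (hc : HasCompactSupport m)
    (f : L2Scal) : MemLp (fun x => f x * m x) 2 volume := by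
  have h : MemLp (fun x => m x • f x) 2 volume :=
    (Lp.memLp f).smul (r := 2) (hm.memLp_of_hasCompactSupport (p := ⊤) hc)
  simpa [mul_comm] using h

/-- Multiplication by a continuous compactly supported function, as an operator on `L²`. -/
noncomputable def mulTest (m : Space → ℝ) (hm : Continuous m) (hc : HasCompactSupport m) :
    L2Scal →ₗ[ℝ] L2Scal where
  toFun f := (memLp_mul_test hm hc f).toLp _
  map_add' f g := by
    rw [← MemLp.toLp_add]
    refine MemLp.toLp_congr _ ((memLp_mul_test hm hc f).add (memLp_mul_test hm hc g)) ?_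
    filter_upwards [Lp.coeFn_add f g] with x hx
    rw [hx, Pi.add_apply, Pi.add_apply, add_mul]
  map_smul' c f := by
    simp only [RingHom.id_apply]
    rw [← MemLp.toLp_const_smul]
    refine MemLp.toLp_congr _ ((memLp_mul_test hm hc f).const_smul c) ?_
    filter_upwards [Lp.coeFn_smul c f] with x hx
    simp [hx, mul_assoc]

lemma coeFn_mulTest (m : Space → ℝ) (hm : Continuous m) (hc : HasCompactSupport m)
    (f : L2Scal) : mulTest m hm hc f =ᵐ[volume] fun x => f x * m x :=
  (memLp_mul_test hm hc f).coeFn_toLp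

lemma norm_mulTest_le {m : Space → ℝ} (hm : Continuous m) (hc : HasCompactSupport m) {M : ℝ}
    (hM : ∀ x, |m x| ≤ M) (f : L2Scal) : ‖mulTest m hm hc f‖ ≤ M * ‖f‖ := by
  apply Lp.norm_le_mul_norm_of_ae_le_mul
  filter_upwards [coeFn_mulTest m hm hc f] with x hx
  rw [hx, norm_mul, mul_comm]
  exact mul_le_mul_of_nonneg_right (hM x) (norm_nonneg _)

lemma continuous_mulTest (m : Space → ℝ) (hm : Continuous m) (hc : HasCompactSupport m) :
    Continuous (mulTest m hm hc) := by
  obtain ⟨M, hM⟩ := hm.bounded_above_of_compact_support hc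
  exact AddMonoidHomClass.continuous_of_bound _ M fun f => norm_mulTest_le hm hc hM f

/-- A smooth compactly supported vector field on `ℝ³`, given by its components. -/
structure TestField where
  /-- The components. -/
  toFun : Fin 3 → Space → ℝ
  smooth : ∀ i, ContDiff ℝ ∞ (toFun i)
  compact : ∀ i, HasCompactSupport (toFun i)

namespace TestField

variable (Ψ : TestField)

/-- The components of a test field in `L²`. -/
noncomputable def val (i : Fin 3) : L2Scal :=
  ((Ψ.smooth i).continuous.memLp_of_hasCompactSupport (p := 2) (μ := volume) (Ψ.compact i)).toLp _

lemma coeFn_val (i : Fin 3) : Ψ.val i =ᵐ[volume] Ψ.toFun i := MemLp.coeFn_toLp _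

/-- The partial derivatives `∂ⱼΨᵢ` of a test field in `L²`. -/
noncomputable def grad (i j : Fin 3) : L2Scal :=
  ((contDiff_fderiv_apply (Ψ.smooth i) (e j)).continuous.memLp_of_hasCompactSupport (p := 2)
    (μ := volume) (hasCompactSupport_fderiv_apply (Ψ.compact i) (e j))).toLp _

lemma coeFn_grad (i j : Fin 3) :
    Ψ.grad i j =ᵐ[volume] fun x => fderiv ℝ (Ψ.toFun i) x (e j) := MemLp.coeFn_toLp _

/-- Multiplication by the `i`-th component. -/
noncomputable def mul (i : Fin 3) : L2Scal →ₗ[ℝ] L2Scal :=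
  mulTest (Ψ.toFun i) (Ψ.smooth i).continuous (Ψ.compact i)

lemma coeFn_mul (i : Fin 3) (f : L2Scal) : Ψ.mul i f =ᵐ[volume] fun x => f x * Ψ.toFun i x :=
  coeFn_mulTest _ _ _ f

end TestField

/-- The pairing of a vector field with a triple of scalar functions. -/
noncomputable def pair (U : L2Vec) (Φ : Fin 3 → L2Scal) : ℝ :=
  ∑ i, inner ℝ (coord i U) (Φ i)

/-- The space part of the weak form of the momentum equation, tested with `Ψ`. -/
noncomputable def momForm (Ψ : TestField) (i : Fin 3) (P : L2Scal) (U : L2Vec)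
    (D : Fin 3 → L2Vec) : ℝ :=
  -inner ℝ P (Ψ.grad i i) + ∑ j, inner ℝ (coord i (D j)) (Ψ.grad i j)
    + ∑ j, inner ℝ (coord j U) (Ψ.mul i (coord i (D j)))
    + 1 / 2 * ∑ j, inner ℝ (coord i U) (Ψ.mul i (coord j (D j)))

/-- The numbers `r` and `s` stand for `η'(t)` and `η(t)`; for a test function `η(t) Ψᵢ(x)` the space
integral of the weak formulation separates in this way. -/
lemma integral_momentum_integrand (Ψ : TestField) (i : Fin 3) (P : L2Scal) (U : L2Vec)
    (D : Fin 3 → L2Vec) (r s : ℝ) :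
    ∫ x, (-(U x i * (r * Ψ.toFun i x)) - P x * (s * fderiv ℝ (Ψ.toFun i) x (e i))
        + ∑ j, D j x i * (s * fderiv ℝ (Ψ.toFun i) x (e j))
        + (∑ j, U x j * D j x i) * (s * Ψ.toFun i x)
        + 1 / 2 * (∑ j, D j x j) * U x i * (s * Ψ.toFun i x))
      = -(r * inner ℝ (coord i U) (Ψ.val i)) + s * momForm Ψ i P U D := by
  have h := (((HasInt.inner (coord i U) (Ψ.val i)).const_mul r).neg).add
    ((((((HasInt.inner P (Ψ.grad i i)).neg).add
      (HasInt.sum fun j => HasInt.inner (coord i (D j)) (Ψ.grad i j))).add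
      (HasInt.sum fun j => HasInt.inner (coord j U) (Ψ.mul i (coord i (D j))))).add
      ((HasInt.sum fun j => HasInt.inner (coord i U)
        (Ψ.mul i (coord j (D j)))).const_mul (1 / 2))).const_mul s)
  refine (h.congr ?_).2
  have c1 : ∀ᵐ x, ∀ i, coord i U x = U x i := ae_all_iff.2 fun i => coeFn_coord i U
  have c2 : ∀ᵐ x, ∀ i j, coord i (D j) x = D j x i :=
    ae_all_iff.2 fun i => ae_all_iff.2 fun j => coeFn_coord i (D j)
  have c3 : ∀ᵐ x, ∀ j, Ψ.grad i j x = fderiv ℝ (Ψ.toFun i) x (e j) :=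
    ae_all_iff.2 fun j => Ψ.coeFn_grad i j
  have c4 : ∀ᵐ x, ∀ k j, Ψ.mul i (coord k (D j)) x = coord k (D j) x * Ψ.toFun i x :=
    ae_all_iff.2 fun k => ae_all_iff.2 fun j => Ψ.coeFn_mul i _
  filter_upwards [c1, c2, c3, c4, Ψ.coeFn_val i] with x c1 c2 c3 c4 c5
  simp only [c1, c2, c3, c4, c5, Fin.sum_univ_three]
  ring

/-! ### Testing with products of a time and a space function -/

section Product

variable {S : ℝ} {η : ℝ → ℝ} {ζ : Space → ℝ}

lemma isTest_mul (hη : ContDiff ℝ ∞ η) (hηc : HasCompactSupport η) (hηs : tsupport η ⊆ Ioo 0 S)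
    (hζ : ContDiff ℝ ∞ ζ) (hζc : HasCompactSupport ζ) :
    IsTest S (fun q => η q.1 * ζ q.2) := by
  have hsub : tsupport (fun q : ℝ × Space => η q.1 * ζ q.2) ⊆ tsupport η ×ˢ tsupport ζ := by
    refine closure_minimal (fun q hq => ?_) ((isClosed_tsupport _).prod (isClosed_tsupport _))
    exact ⟨subset_tsupport _ (left_ne_zero_of_mul hq), subset_tsupport _ (right_ne_zero_of_mul hq)⟩
  refine ⟨(hη.comp contDiff_fst).mul (hζ.comp contDiff_snd), ?_, ?_⟩
  · exact (hηc.isCompact.prod hζc.isCompact).of_isClosed_subset (isClosed_tsupport _) hsub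
  · exact fun q hq => ⟨(hηs (hsub hq).1).2, mem_univ _⟩

lemma hasFDerivAt_mul_test (hη : ContDiff ℝ ∞ η) (hζ : ContDiff ℝ ∞ ζ) (t : ℝ) (x : Space) :
    HasFDerivAt (fun q : ℝ × Space => η q.1 * ζ q.2)
      (η t • (fderiv ℝ ζ x).comp (ContinuousLinearMap.snd ℝ ℝ Space)
        + ζ x • (fderiv ℝ η t).comp (ContinuousLinearMap.fst ℝ ℝ Space)) (t, x) := by
  have h1 : HasFDerivAt (fun q : ℝ × Space => η q.1)
      ((fderiv ℝ η t).comp (ContinuousLinearMap.fst ℝ ℝ Space)) (t, x) :=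
    HasFDerivAt.comp (t, x) ((hη.differentiable (by simp)).differentiableAt.hasFDerivAt)
      hasFDerivAt_fst
  have h2 : HasFDerivAt (fun q : ℝ × Space => ζ q.2)
      ((fderiv ℝ ζ x).comp (ContinuousLinearMap.snd ℝ ℝ Space)) (t, x) :=
    HasFDerivAt.comp (t, x) ((hζ.differentiable (by simp)).differentiableAt.hasFDerivAt)
      hasFDerivAt_snd
  exact h1.mul h2

lemma dt_mul (hη : ContDiff ℝ ∞ η) (hζ : ContDiff ℝ ∞ ζ) (t : ℝ) (x : Space) :
    dt (fun q => η q.1 * ζ q.2) t x = deriv η t * ζ x := by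
  rw [dt, (hasFDerivAt_mul_test hη hζ t x).fderiv]
  simp [mul_comm]

lemma dx_mul (hη : ContDiff ℝ ∞ η) (hζ : ContDiff ℝ ∞ ζ) (j : Fin 3) (t : ℝ) (x : Space) :
    dx j (fun q => η q.1 * ζ q.2) t x = η t * fderiv ℝ ζ x (e j) := by
  rw [dx, (hasFDerivAt_mul_test hη hζ t x).fderiv]
  simp

end Product

lemma integrable_inner_of_memLp {μ : Measure ℝ} {f g : ℝ → L2Scal} (hf : MemLp f 2 μ)
    (hg : MemLp g 2 μ) : Integrable (fun t => inner ℝ (f t) (g t)) μ :=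
  (hf.norm.integrable_mul hg.norm).mono' (hf.1.inner hg.1)
    (Eventually.of_forall fun _ => norm_inner_le_norm _ _)

lemma MemLp.comp_lin {μ : Measure ℝ} {f : ℝ → L2Scal} (hf : MemLp f 2 μ)
    {L : L2Scal →ₗ[ℝ] L2Scal} (hL : Continuous L) : MemLp (fun t => L (f t)) 2 μ :=
  (⟨L, hL⟩ : L2Scal →L[ℝ] L2Scal).comp_memLp' hf

section Solution

variable {S ε : ℝ} {u₀ : L2Vec} {θ₀ p₀ : L2Scal} {u : ℝ → L2Vec} {θ p : ℝ → L2Scal}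
  {Du : Fin 3 → ℝ → L2Vec} {Dθ : Fin 3 → ℝ → L2Scal}

namespace IsWeakSolutionWith

lemma memLp_u (hs : IsWeakSolutionWith S ε u₀ θ₀ p₀ u θ p Du Dθ) :
    MemLp u 2 (volume.restrict (Ioo 0 S)) :=
  hs.u_mem.mono_exponent le_top

lemma memLp_p (hs : IsWeakSolutionWith S ε u₀ θ₀ p₀ u θ p Du Dθ) (hε : 0 < ε) :
    MemLp p 2 (volume.restrict (Ioo 0 S)) := by
  have h := (hs.p_mem.const_smul (√ε)⁻¹).mono_exponent (p := 2) le_top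
  convert h using 1
  ext1 t
  simp [smul_smul, (Real.sqrt_pos.2 hε).ne']

lemma integrable_momForm (hs : IsWeakSolutionWith S ε u₀ θ₀ p₀ u θ p Du Dθ) (hε : 0 < ε)
    (Ψ : TestField) (i : Fin 3) :
    IntegrableOn (fun t => momForm Ψ i (p t) (u t) (fun j => Du j t)) (Ioo 0 S) := by
  have hu : ∀ k, MemLp (fun t => coord k (u t)) 2 (volume.restrict (Ioo 0 S)) := fun k =>
    (coord k).comp_memLp' hs.memLp_u
  have hD : ∀ k j, MemLp (fun t => coord k (Du j t)) 2 (volume.restrict (Ioo 0 S)) := fun k j =>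
    (coord k).comp_memLp' (hs.Du_mem j)
  have hm : ∀ k j, MemLp (fun t => Ψ.mul i (coord k (Du j t))) 2 (volume.restrict (Ioo 0 S)) :=
    fun k j => MemLp.comp_lin (hD k j) (continuous_mulTest _ _ _)
  refine ((Integrable.neg ?_).add ?_ |>.add ?_).add (Integrable.const_mul ?_ _)
  · exact integrable_inner_of_memLp (hs.memLp_p hε) (memLp_const _)
  · exact integrable_finsetSum _ fun j _ => integrable_inner_of_memLp (hD i j) (memLp_const _)
  · exact integrable_finsetSum _ fun j _ => integrable_inner_of_memLp (hu j) (hm i j)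
  · exact integrable_finsetSum _ fun j _ => integrable_inner_of_memLp (hu i) (hm j j)

lemma weak_momentum (hs : IsWeakSolutionWith S ε u₀ θ₀ p₀ u θ p Du Dθ) (hε : 0 < ε)
    (Ψ : TestField) {η : ℝ → ℝ} (hη : ContDiff ℝ ∞ η) (hηc : HasCompactSupport η)
    (hηs : tsupport η ⊆ Ioo 0 S) :
    ∫ t in Ioo 0 S, (-(deriv η t * pair (u t) Ψ.val)
      + η t * ∑ i, momForm Ψ i (p t) (u t) (fun j => Du j t)) = 0 := by
  have hi : ∀ i, ∫ t in Ioo 0 S, (-(deriv η t * inner ℝ (coord i (u t)) (Ψ.val i))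
      + η t * momForm Ψ i (p t) (u t) (fun j => Du j t)) = 0 := by
    intro i
    have h := hs.momentum i _ (isTest_mul hη hηc hηs (Ψ.smooth i) (Ψ.compact i))
    -- The time factor vanishes at zero, so the initial data disappear here; they enter only through
    -- the energy.
    have h0 : η 0 = 0 := by
      by_contra hne
      exact lt_irrefl _ (hηs (subset_tsupport _ hne)).1
    simp only [dt_mul hη (Ψ.smooth i), dx_mul hη (Ψ.smooth i), h0, zero_mul, mul_zero,
      integral_zero] at h
    refine Eq.trans ?_ h
    refine integral_congr_ae (Eventually.of_forall fun t => ?_)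
    exact (integral_momentum_integrand Ψ i (p t) (u t) (fun j => Du j t) _ _).symm
  obtain ⟨M, hM⟩ := hη.continuous.bounded_above_of_compact_support hηc
  have hηd : Continuous (deriv η) := hη.continuous_deriv (by simp)
  obtain ⟨N, hN⟩ := hηd.bounded_above_of_compact_support hηc.deriv
  have hint : ∀ i, IntegrableOn (fun t => -(deriv η t * inner ℝ (coord i (u t)) (Ψ.val i))
      + η t * momForm Ψ i (p t) (u t) (fun j => Du j t)) (Ioo 0 S) := by
    intro i
    have h1 : Integrable (fun t => inner ℝ (coord i (u t)) (Ψ.val i))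
        (volume.restrict (Ioo 0 S)) :=
      integrable_inner_of_memLp ((coord i).comp_memLp' hs.memLp_u) (memLp_const _)
    exact (h1.bdd_mul hηd.aestronglyMeasurable (Eventually.of_forall hN)).neg.add
      ((hs.integrable_momForm hε Ψ i).bdd_mul hη.continuous.aestronglyMeasurable
        (Eventually.of_forall hM))
  refine Eq.trans ?_ (Finset.sum_eq_zero (s := Finset.univ) fun i _ => hi i)
  rw [← integral_finsetSum _ fun i _ => hint i]
  refine integral_congr_ae (Eventually.of_forall fun t => ?_)
  simp only
  rw [Finset.sum_add_distrib, Finset.sum_neg_distrib, ← Finset.mul_sum, ← Finset.mul_sum]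
  rfl

/-- The null set depends on `Ψ`, so a test field that varies with `t` cannot be inserted directly;
`ae_abs_pair_le` repairs this. -/
lemma pair_sub_eq (hs : IsWeakSolutionWith S ε u₀ θ₀ p₀ u θ p Du Dθ) (hε : 0 < ε)
    (Ψ : TestField) {h : ℝ} (hh : 0 < h) :
    ∀ᵐ t, t ∈ Ioo 0 (S - h) → pair (u (t + h)) Ψ.val - pair (u t) Ψ.val
      = -∫ s in Ioo t (t + h), ∑ i, momForm Ψ i (p s) (u s) (fun j => Du j s) := by
  refine sub_shift_eq_integral_of_weak hh ?_ ?_ fun η h1 h2 h3 => hs.weak_momentum hε Ψ h1 h2 h3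
  · exact integrable_finsetSum _ fun i _ => integrable_inner_of_memLp
      ((coord i).comp_memLp' hs.memLp_u) (memLp_const _)
  · exact integrable_finsetSum _ fun i _ => hs.integrable_momForm hε Ψ i

end IsWeakSolutionWith

/-- The pressure terms are kept together so that they see only the divergence of `Ψ`, of size `δ`.
The three diffusion rows give `3 * G`; convection gives `3` and the half-divergence term `3/2`,
rounded up to `5` in total. -/
lemma abs_sum_momForm_le (Ψ : TestField) (P : L2Scal) (U : L2Vec) (D : Fin 3 → L2Vec)
    {M G δ : ℝ} (hM : ∀ i x, |Ψ.toFun i x| ≤ M) (hG : ∀ i j, ‖Ψ.grad i j‖ ≤ G)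
    (hδ : ‖∑ i, Ψ.grad i i‖ ≤ δ) :
    |∑ i, momForm Ψ i P U D| ≤ ‖P‖ * δ + (3 * G + 5 * (‖U‖ * M)) * ∑ j, ‖D j‖ := by
  have hM0 : 0 ≤ M := (abs_nonneg _).trans (hM 0 0)
  have h1 : |∑ i, -inner ℝ P (Ψ.grad i i)| ≤ ‖P‖ * δ := by
    rw [Finset.sum_neg_distrib, abs_neg, ← inner_sum]
    exact (abs_real_inner_le_norm _ _).trans (by gcongr)
  have h2 : ∀ i, |∑ j, inner ℝ (coord i (D j)) (Ψ.grad i j)| ≤ G * ∑ j, ‖D j‖ := by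
    intro i
    rw [Finset.mul_sum]
    refine (Finset.abs_sum_le_sum_abs _ _).trans (Finset.sum_le_sum fun j _ => ?_)
    refine (abs_real_inner_le_norm _ _).trans ?_
    rw [mul_comm]
    exact mul_le_mul (hG i j) (norm_coord_le _ _) (norm_nonneg _) ((norm_nonneg _).trans (hG i j))
  have h3 : ∀ i k l j, |inner ℝ (coord k U) (Ψ.mul i (coord l (D j)))| ≤ ‖U‖ * M * ‖D j‖ := by
    intro i k l j
    refine (abs_real_inner_le_norm _ _).trans ?_
    rw [mul_assoc]
    refine mul_le_mul (norm_coord_le _ _) ?_ (norm_nonneg _) (norm_nonneg _)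
    exact (norm_mulTest_le _ _ (hM i) _).trans (by gcongr; exact norm_coord_le _ _)
  have h4 : ∀ i, |∑ j, inner ℝ (coord j U) (Ψ.mul i (coord i (D j)))|
      ≤ ‖U‖ * M * ∑ j, ‖D j‖ := by
    intro i
    rw [Finset.mul_sum]
    exact (Finset.abs_sum_le_sum_abs _ _).trans (Finset.sum_le_sum fun j _ => h3 _ _ _ _)
  have h5 : ∀ i, |∑ j, inner ℝ (coord i U) (Ψ.mul i (coord j (D j)))|
      ≤ ‖U‖ * M * ∑ j, ‖D j‖ := by
    intro i
    rw [Finset.mul_sum]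
    exact (Finset.abs_sum_le_sum_abs _ _).trans (Finset.sum_le_sum fun j _ => h3 _ _ _ _)
  have h6 : 0 ≤ ‖U‖ * M * ∑ j, ‖D j‖ :=
    mul_nonneg (by positivity) (Finset.sum_nonneg fun j _ => norm_nonneg _)
  simp only [momForm, Finset.sum_add_distrib]
  have a2 := (abs_le.1 (h2 0)).1; have b2 := (abs_le.1 (h2 0)).2
  have a2' := (abs_le.1 (h2 1)).1; have b2' := (abs_le.1 (h2 1)).2
  have a2'' := (abs_le.1 (h2 2)).1; have b2'' := (abs_le.1 (h2 2)).2
  have a4 := (abs_le.1 (h4 0)).1; have b4 := (abs_le.1 (h4 0)).2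
  have a4' := (abs_le.1 (h4 1)).1; have b4' := (abs_le.1 (h4 1)).2
  have a4'' := (abs_le.1 (h4 2)).1; have b4'' := (abs_le.1 (h4 2)).2
  have a5 := (abs_le.1 (h5 0)).1; have b5 := (abs_le.1 (h5 0)).2
  have a5' := (abs_le.1 (h5 1)).1; have b5' := (abs_le.1 (h5 1)).2
  have a5'' := (abs_le.1 (h5 2)).1; have b5'' := (abs_le.1 (h5 2)).2
  have e1 : ∀ f : Fin 3 → ℝ, ∑ i, f i = f 0 + f 1 + f 2 := fun f => Fin.sum_univ_three f
  rw [e1 fun i => ∑ j, inner ℝ (coord i (D j)) (Ψ.grad i j),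
    e1 fun i => ∑ j, inner ℝ (coord j U) (Ψ.mul i (coord i (D j))),
    e1 fun i => 1 / 2 * ∑ j, inner ℝ (coord i U) (Ψ.mul i (coord j (D j)))]
  rw [abs_le] at h1 ⊢
  constructor <;> linarith [h1.1, h1.2]

end Solution

/-! ### Divergence free fields: mollification and truncation -/

lemma integral_inner_gradient_eq_zero {V : L2Vec} (hV : V ∈ solenoidal) {φ : Space → ℝ}
    (hφ : ContDiff ℝ ∞ φ) (hc : HasCompactSupport φ) :
    ∑ i, ∫ x, fderiv ℝ φ x (e i) * V x i = 0 := by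
  have hgc : Continuous (gradient φ) :=
    (InnerProductSpace.toDual ℝ Space).symm.continuous.comp (hφ.continuous_fderiv (by simp))
  have hgs : HasCompactSupport (gradient φ) :=
    (hc.fderiv ℝ).comp_left (g := (InnerProductSpace.toDual ℝ Space).symm) (map_zero _)
  have hg : MemLp (gradient φ) 2 volume := hgc.memLp_of_hasCompactSupport hgs
  have h0 : inner ℝ (hg.toLp _) V = 0 :=
    (Submodule.mem_orthogonal _ _).1 hV _ (Submodule.subset_span ⟨φ, hφ, hc, hg.coeFn_toLp⟩)
  rw [L2.inner_def] at h0
  rw [← h0, ← integral_finsetSum]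
  · apply integral_congr_ae
    filter_upwards [hg.coeFn_toLp] with x hx
    rw [hx, gradient, InnerProductSpace.toDual_symm_apply]
    conv_rhs => rw [← sum_smul_e (V x)]
    rw [map_sum]
    refine Finset.sum_congr rfl fun i _ => ?_
    rw [map_smul, smul_eq_mul, mul_comm]
  · intro i _
    exact integrable_mul_of_memLp
      ((contDiff_fderiv_apply hφ (e i)).continuous.memLp_of_hasCompactSupport
        (hasCompactSupport_fderiv_apply hc (e i))) (memLp_coord i V)

lemma fderiv_comp_sub_left {k : Space → ℝ} (hk : ContDiff ℝ ∞ k) (x y w : Space) :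
    fderiv ℝ (fun y => k (x - y)) y w = -fderiv ℝ k (x - y) w := by
  have h1 : HasFDerivAt k (fderiv ℝ k (x - y)) (x - y) :=
    (hk.differentiable (by simp)).differentiableAt.hasFDerivAt
  have h2 := (h1.comp y ((hasFDerivAt_id y).const_sub x)).fderiv
  have h3 : fderiv ℝ (fun y => k (x - y)) y = _ := h2
  rw [h3]
  simp

/-- Mollification preserves the divergence free condition. -/
lemma sum_fderiv_conv_eq_zero {V : L2Vec} (hV : V ∈ solenoidal) {k : Space → ℝ}
    (hk : ContDiff ℝ ∞ k) (hc : HasCompactSupport k) (x : Space) :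
    ∑ i, fderiv ℝ (conv k (coord i V)) x (e i) = 0 := by
  have hcx : HasCompactSupport (fun y => k (x - y)) := hc.comp_homeomorph (Homeomorph.subLeft x)
  have hkx : ContDiff ℝ ∞ (fun y => k (x - y)) := hk.comp (contDiff_const.sub contDiff_id)
  -- For fixed `x` the kernel `y ↦ k(x - y)` is itself an admissible potential, and its gradient in
  -- `y` is minus the gradient of `k` at `x - y`.
  have h := integral_inner_gradient_eq_zero hV hkx hcx
  rw [← neg_eq_zero, ← Finset.sum_neg_distrib, ← h]
  refine Finset.sum_congr rfl fun i _ => ?_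
  rw [fderiv_conv hk hc, conv_apply, ← integral_neg]
  apply integral_congr_ae
  filter_upwards [coeFn_coord i V] with y hy
  rw [hy, fderiv_comp_sub_left hk]
  ring

/-- A fixed cutoff function, equal to one on the unit ball. -/
noncomputable def baseCutoff : ContDiffBump (0 : Space) where
  rIn := 1
  rOut := 2
  rIn_pos := by norm_num
  rIn_lt_rOut := by norm_num

/-- The cutoff function at scale `n + 1`. -/
noncomputable def cutoff (n : ℕ) (x : Space) : ℝ := baseCutoff (((n : ℝ) + 1)⁻¹ • x)

lemma contDiff_cutoff (n : ℕ) : ContDiff ℝ ∞ (cutoff n) :=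
  baseCutoff.contDiff.comp (contDiff_id.const_smul _)

lemma hasCompactSupport_cutoff (n : ℕ) : HasCompactSupport (cutoff n) :=
  baseCutoff.hasCompactSupport.comp_smul (inv_ne_zero (by positivity))

lemma abs_cutoff_le (n : ℕ) (x : Space) : |cutoff n x| ≤ 1 := by
  rw [cutoff, abs_of_nonneg baseCutoff.nonneg]
  exact baseCutoff.le_one

lemma tendsto_inv_nat_add_one : Tendsto (fun n : ℕ => ((n : ℝ) + 1)⁻¹) atTop (𝓝 0) := by
  simpa using tendsto_one_div_add_atTop_nhds_zero_nat (𝕜 := ℝ)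

lemma tendsto_cutoff (x : Space) : Tendsto (fun n => cutoff n x) atTop (𝓝 1) := by
  have h1 : Tendsto (fun n : ℕ => ((n : ℝ) + 1)⁻¹ • x) atTop (𝓝 ((0 : ℝ) • x)) :=
    tendsto_inv_nat_add_one.smul_const x
  rw [zero_smul] at h1
  have h2 := (baseCutoff.continuous.tendsto 0).comp h1
  rwa [baseCutoff.one_of_mem_closedBall (by simp [baseCutoff])] at h2

lemma exists_fderiv_cutoff_le : ∃ L : ℝ, 0 ≤ L ∧ ∀ n x j,
    |fderiv ℝ (cutoff n) x (e j)| ≤ L * ((n : ℝ) + 1)⁻¹ := by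
  have hd : ContDiff ℝ ∞ baseCutoff := baseCutoff.contDiff
  obtain ⟨L, hL⟩ := (hd.continuous_fderiv (by simp)).bounded_above_of_compact_support
    (baseCutoff.hasCompactSupport.fderiv ℝ)
  refine ⟨L, (norm_nonneg _).trans (hL 0), fun n x j => ?_⟩
  have h1 : HasFDerivAt baseCutoff (fderiv ℝ baseCutoff (((n : ℝ) + 1)⁻¹ • x))
      (((n : ℝ) + 1)⁻¹ • x) :=
    (hd.differentiable (by simp)).differentiableAt.hasFDerivAt
  have h2 : fderiv ℝ (cutoff n) x = _ :=
    (h1.comp x ((hasFDerivAt_id x).const_smul ((n : ℝ) + 1)⁻¹)).fderiv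
  have h3 : ‖fderiv ℝ baseCutoff (((n : ℝ) + 1)⁻¹ • x) (e j)‖ ≤ L := by
    refine (ContinuousLinearMap.le_opNorm _ _).trans ?_
    have : ‖e j‖ = 1 := by simp [e]
    rw [this, mul_one]
    exact hL _
  rw [h2]
  simp only [ContinuousLinearMap.comp_smul, ContinuousLinearMap.comp_id,
    smul_apply, smul_eq_mul, abs_mul]
  rw [abs_of_nonneg (by positivity), mul_comm]
  exact mul_le_mul_of_nonneg_right h3 (by positivity)

lemma fderiv_cutoff_mul (n : ℕ) {f : Space → ℝ} (hf : ContDiff ℝ ∞ f) (x w : Space) :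
    fderiv ℝ (fun x => cutoff n x * f x) x w
      = cutoff n x * fderiv ℝ f x w + fderiv ℝ (cutoff n) x w * f x := by
  have h1 : HasFDerivAt (cutoff n) (fderiv ℝ (cutoff n) x) x :=
    ((contDiff_cutoff n).differentiable (by simp)).differentiableAt.hasFDerivAt
  have h2 : HasFDerivAt f (fderiv ℝ f x) x :=
    (hf.differentiable (by simp)).differentiableAt.hasFDerivAt
  have h3 : fderiv ℝ (fun x => cutoff n x * f x) x = _ := (h1.mul h2).fderiv
  rw [h3]
  simp [mul_comm]

/-- The truncation of a smooth vector field to a test field. -/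
noncomputable def truncate (n : ℕ) (ψ : Fin 3 → Space → ℝ) (hψ : ∀ i, ContDiff ℝ ∞ (ψ i)) :
    TestField where
  toFun i x := cutoff n x * ψ i x
  smooth i := (contDiff_cutoff n).mul (hψ i)
  compact _ := (hasCompactSupport_cutoff n).mul_right

/-- Dominated convergence: the cutoffs are bounded by one and tend to one pointwise. -/
lemma tendsto_pair_truncate {ψ : Fin 3 → Space → ℝ} (hψ : ∀ i, ContDiff ℝ ∞ (ψ i))
    {Φ : Fin 3 → L2Scal} (hΦ : ∀ i, Φ i =ᵐ[volume] ψ i) (U : L2Vec) :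
    Tendsto (fun n => pair U (truncate n ψ hψ).val) atTop (𝓝 (pair U Φ)) := by
  refine tendsto_finsetSum _ fun i _ => ?_
  simp_rw [inner_eq_integral]
  refine tendsto_integral_of_dominated_convergence (fun x => ‖coord i U x * Φ i x‖) ?_ ?_ ?_ ?_
  · intro n
    exact (integrable_mul_of_memLp (Lp.memLp _) (Lp.memLp _)).1
  · exact (integrable_mul_of_memLp (Lp.memLp _) (Lp.memLp _)).norm
  · intro n
    filter_upwards [hΦ i, (truncate n ψ hψ).coeFn_val i] with x h1 h2
    rw [h1, h2, norm_mul, norm_mul]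
    refine mul_le_mul_of_nonneg_left ?_ (norm_nonneg _)
    change ‖cutoff n x * ψ i x‖ ≤ _
    rw [norm_mul]
    exact mul_le_of_le_one_left (norm_nonneg _) (abs_cutoff_le n x)
  · filter_upwards [hΦ i, ae_all_iff.2 fun n => (truncate n ψ hψ).coeFn_val i] with x h1 h2
    simp_rw [h1, h2]
    have := ((tendsto_cutoff x).mul_const (ψ i x)).const_mul (coord i U x)
    rwa [one_mul] at this

lemma norm_grad_truncate_le {L : ℝ} (hL : ∀ n x j,
      |fderiv ℝ (cutoff n) x (e j)| ≤ L * ((n : ℝ) + 1)⁻¹)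
    {ψ : Fin 3 → Space → ℝ} (hψ : ∀ i, ContDiff ℝ ∞ (ψ i)) (hψ2 : ∀ i, MemLp (ψ i) 2 volume)
    (hψ' : ∀ i j, MemLp (fun x => fderiv ℝ (ψ i) x (e j)) 2 volume) {G N : ℝ}
    (hG : ∀ i j, l2 (fun x => fderiv ℝ (ψ i) x (e j)) ≤ G) (hN : ∀ i, l2 (ψ i) ≤ N) (n : ℕ)
    (i j : Fin 3) : ‖(truncate n ψ hψ).grad i j‖ ≤ G + L * ((n : ℝ) + 1)⁻¹ * N := by
  have hL0 : 0 ≤ L * ((n : ℝ) + 1)⁻¹ := (abs_nonneg _).trans (hL n 0 0)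
  have hm1 : MemLp (fun x => cutoff n x * fderiv ℝ (ψ i) x (e j)) 2 volume := by
    refine (hψ' i j).mono ((contDiff_cutoff n).continuous.aestronglyMeasurable.mul (hψ' i j).1)
      (Eventually.of_forall fun x => ?_)
    rw [norm_mul]
    exact mul_le_of_le_one_left (norm_nonneg _) (abs_cutoff_le n x)
  have hm2' : MemLp (fun x => L * ((n : ℝ) + 1)⁻¹ * ψ i x) 2 volume := (hψ2 i).const_mul _
  have hle : ∀ x, |fderiv ℝ (cutoff n) x (e j) * ψ i x| ≤ |L * ((n : ℝ) + 1)⁻¹ * ψ i x| := by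
    intro x
    rw [abs_mul, abs_mul, abs_of_nonneg hL0]
    exact mul_le_mul_of_nonneg_right (hL n x j) (abs_nonneg _)
  have hm2 : MemLp (fun x => fderiv ℝ (cutoff n) x (e j) * ψ i x) 2 volume :=
    hm2'.mono ((contDiff_fderiv_apply (contDiff_cutoff n) (e j)).continuous.aestronglyMeasurable.mul
      (hψ2 i).1) (Eventually.of_forall hle)
  have h1 : ‖(truncate n ψ hψ).grad i j‖ = l2 (fun x => cutoff n x * fderiv ℝ (ψ i) x (e j)
      + fderiv ℝ (cutoff n) x (e j) * ψ i x) := by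
    rw [norm_eq_l2, l2_congr ((truncate n ψ hψ).coeFn_grad i j)]
    congr 1 with x
    exact fderiv_cutoff_mul n (hψ i) x (e j)
  rw [h1]
  refine (l2_add_le hm1 hm2).trans (add_le_add ?_ ?_)
  · refine (l2_le_of_abs_le (hψ' i j) fun x => ?_).trans (hG i j)
    rw [abs_mul]
    exact mul_le_of_le_one_left (abs_nonneg _) (abs_cutoff_le n x)
  · refine (l2_le_of_abs_le hm2' hle).trans ?_
    rw [l2_const_mul, abs_of_nonneg hL0]
    exact mul_le_mul_of_nonneg_left (hN i) hL0

/-- By the product rule only `∇χₙ · ψ` survives, `ψ` being divergence free, and `∇χₙ` is of order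
`1/n`. This smallness is what removes the pressure in the limit. -/
lemma norm_div_truncate_le {L : ℝ} (hL : ∀ n x j,
      |fderiv ℝ (cutoff n) x (e j)| ≤ L * ((n : ℝ) + 1)⁻¹)
    {ψ : Fin 3 → Space → ℝ} (hψ : ∀ i, ContDiff ℝ ∞ (ψ i)) (hψ2 : ∀ i, MemLp (ψ i) 2 volume)
    (hdiv : ∀ x, ∑ i, fderiv ℝ (ψ i) x (e i) = 0) {N : ℝ}
    (hN : ∀ i, l2 (ψ i) ≤ N) (n : ℕ) :
    ‖∑ i, (truncate n ψ hψ).grad i i‖ ≤ 3 * (L * ((n : ℝ) + 1)⁻¹ * N) := by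
  have hL0 : 0 ≤ L * ((n : ℝ) + 1)⁻¹ := (abs_nonneg _).trans (hL n 0 0)
  have hm : ∀ i, MemLp (fun x => L * ((n : ℝ) + 1)⁻¹ * |ψ i x|) 2 volume := fun i =>
    (hψ2 i).abs.const_mul _
  have hs : MemLp (fun x => L * ((n : ℝ) + 1)⁻¹ * |ψ 0 x| + L * ((n : ℝ) + 1)⁻¹ * |ψ 1 x|) 2
    volume := (hm 0).add (hm 1)
  have hs' : MemLp (fun x => L * ((n : ℝ) + 1)⁻¹ * |ψ 0 x| + L * ((n : ℝ) + 1)⁻¹ * |ψ 1 x|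
    + L * ((n : ℝ) + 1)⁻¹ * |ψ 2 x|) 2 volume := hs.add (hm 2)
  have hl : ∀ i, l2 (fun x => L * ((n : ℝ) + 1)⁻¹ * |ψ i x|) ≤ L * ((n : ℝ) + 1)⁻¹ * N := by
    intro i
    rw [l2_const_mul, l2_abs, abs_of_nonneg hL0]
    exact mul_le_mul_of_nonneg_left (hN i) hL0
  have hae : (∑ i, (truncate n ψ hψ).grad i i : L2Scal)
      =ᵐ[volume] fun x => ∑ i, fderiv ℝ (cutoff n) x (e i) * ψ i x := by
    have h1 := ae_all_iff.2 fun i => (truncate n ψ hψ).coeFn_grad i i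
    rw [Fin.sum_univ_three]
    filter_upwards [h1, Lp.coeFn_add ((truncate n ψ hψ).grad 0 0 + (truncate n ψ hψ).grad 1 1)
      ((truncate n ψ hψ).grad 2 2), Lp.coeFn_add ((truncate n ψ hψ).grad 0 0)
      ((truncate n ψ hψ).grad 1 1)] with x h1 h2 h3
    rw [h2, Pi.add_apply, h3, Pi.add_apply, h1, h1, h1]
    have h4 : ∀ i, fderiv ℝ ((truncate n ψ hψ).toFun i) x (e i) = _ := fun i =>
      fderiv_cutoff_mul n (hψ i) x (e i)
    rw [h4, h4, h4, Fin.sum_univ_three]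
    have h5 := hdiv x
    rw [Fin.sum_univ_three] at h5
    linear_combination cutoff n x * h5
  rw [norm_eq_l2, l2_congr hae]
  refine (l2_le_of_abs_le hs' fun x => ?_).trans ?_
  · refine le_trans ?_ (le_abs_self _)
    refine (Finset.abs_sum_le_sum_abs _ _).trans ?_
    rw [Fin.sum_univ_three, abs_mul, abs_mul, abs_mul]
    gcongr <;> exact hL _ _ _
  · have := l2_add_le hs (hm 2)
    have := l2_add_le (hm 0) (hm 1)
    linarith [hl 0, hl 1, hl 2]

/-! ### Increments of the velocity tested with a mollified solenoidal field -/

/-- The total variation of the normalized bump function. -/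
noncomputable def bumpVar : ℝ := ∑ j, ∫ x, |fderiv ℝ bump x (e j)|

lemma bumpVar_nonneg : 0 ≤ bumpVar :=
  Finset.sum_nonneg fun _ _ => integral_nonneg fun _ => abs_nonneg _

/-- The mollification of a vector field at scale `a`, componentwise. -/
noncomputable def smooth {a : ℝ} (ha : 0 < a) (i : Fin 3) : L2Vec →L[ℝ] L2Scal :=
  (mollify (kernel a) (continuous_kernel a) (hasCompactSupport_kernel ha)).comp (coord i)

namespace IsWeakSolutionWith

variable {S ε : ℝ} {u₀ : L2Vec} {θ₀ p₀ : L2Scal} {u : ℝ → L2Vec} {θ p : ℝ → L2Scal}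
  {Du : Fin 3 → ℝ → L2Vec} {Dθ : Fin 3 → ℝ → L2Scal}

lemma integrableOn_Du (hs : IsWeakSolutionWith S ε u₀ θ₀ p₀ u θ p Du Dθ) :
    IntegrableOn (fun s => ∑ j, ‖Du j s‖) (Ioo 0 S) :=
  integrable_finsetSum _ fun j _ => ((hs.Du_mem j).integrable (by norm_num)).norm

lemma abs_pair_sub_le (hs : IsWeakSolutionWith S ε u₀ θ₀ p₀ u θ p Du Dθ) (hε : 0 < ε)
    (Ψ : TestField) {h : ℝ} (hh : 0 < h) {A B M G δ : ℝ}
    (hu : ∀ᵐ t ∂(volume.restrict (Ioo 0 S)), ‖u t‖ ≤ A)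
    (hp : ∀ᵐ t ∂(volume.restrict (Ioo 0 S)), ‖p t‖ ≤ B)
    (hM : ∀ i x, |Ψ.toFun i x| ≤ M) (hG : ∀ i j, ‖Ψ.grad i j‖ ≤ G)
    (hδ : ‖∑ i, Ψ.grad i i‖ ≤ δ) :
    ∀ᵐ t, t ∈ Ioo 0 (S - h) → |pair (u (t + h)) Ψ.val - pair (u t) Ψ.val|
      ≤ B * δ * h + (3 * G + 5 * (A * M)) * ∫ s in Ioo t (t + h), ∑ j, ‖Du j s‖ := by
  filter_upwards [hs.pair_sub_eq hε Ψ hh] with t ht htm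
  have hsub : Ioo t (t + h) ⊆ Ioo 0 S := fun s hs => ⟨htm.1.trans hs.1, by
    linarith [hs.2, htm.2]⟩
  have hD : IntegrableOn (fun s => ∑ j, ‖Du j s‖) (Ioo t (t + h)) :=
    hs.integrableOn_Du.mono_set hsub
  have hM0 : 0 ≤ M := (abs_nonneg _).trans (hM 0 0)
  have hδ0 : 0 ≤ δ := (norm_nonneg _).trans hδ
  rw [ht htm, abs_neg]
  have hb : IntegrableOn (fun s => B * δ + (3 * G + 5 * (A * M)) * ∑ j, ‖Du j s‖)
      (Ioo t (t + h)) :=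
    (integrableOn_const (by simp)).add (hD.const_mul _)
  calc _ ≤ ∫ s in Ioo t (t + h), (B * δ + (3 * G + 5 * (A * M)) * ∑ j, ‖Du j s‖) := by
        rw [← Real.norm_eq_abs]
        refine norm_integral_le_of_norm_le hb ?_
        filter_upwards [ae_restrict_of_ae_restrict_of_subset hsub hu,
          ae_restrict_of_ae_restrict_of_subset hsub hp] with s h1 h2
        refine (abs_sum_momForm_le Ψ (p s) (u s) (fun j => Du j s) hM hG hδ).trans ?_
        have h3 : 0 ≤ ∑ j, ‖Du j s‖ := Finset.sum_nonneg fun j _ => norm_nonneg _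
        gcongr
    _ = _ := by
        have hc : Integrable (fun _ => B * δ) (volume.restrict (Ioo t (t + h))) :=
          integrableOn_const (by simp)
        rw [integral_add hc (hD.const_mul _), integral_const_mul (3 * G + 5 * (A * M)), setIntegral_const,
          Real.volume_real_Ioo_of_le (by linarith), add_sub_cancel_left, smul_eq_mul, mul_comm h]

/-- The pressure bound `B` is absent from the conclusion, which makes it uniform in `ε`. The bracket
collects diffusion, at cost `a⁻¹`, and convection, at the cost of the sup norm of the mollified
field. -/
lemma abs_pair_smooth_sub_le (hs : IsWeakSolutionWith S ε u₀ θ₀ p₀ u θ p Du Dθ) (hε : 0 < ε)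
    {V : L2Vec} (hV : V ∈ solenoidal) {a : ℝ} (ha : 0 < a) {h : ℝ} (hh : 0 < h) {A B : ℝ}
    (hu : ∀ᵐ t ∂(volume.restrict (Ioo 0 S)), ‖u t‖ ≤ A)
    (hp : ∀ᵐ t ∂(volume.restrict (Ioo 0 S)), ‖p t‖ ≤ B) :
    ∀ᵐ t, t ∈ Ioo 0 (S - h) →
      |pair (u (t + h)) (fun i => smooth ha i V) - pair (u t) (fun i => smooth ha i V)|
      ≤ (3 * (a⁻¹ * bumpVar * ‖V‖) + 5 * (A * (l2 (kernel a) * ‖V‖)))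
        * ∫ s in Ioo t (t + h), ∑ j, ‖Du j s‖ := by
  obtain ⟨L, hL0, hL⟩ := exists_fderiv_cutoff_le
  set ψ : Fin 3 → Space → ℝ := fun i => conv (kernel a) (coord i V) with hψdef
  have hks := hasCompactSupport_kernel ha
  have hψ : ∀ i, ContDiff ℝ ∞ (ψ i) := fun i => contDiff_conv (contDiff_kernel a) hks _
  have hψ2 : ∀ i, MemLp (ψ i) 2 volume := fun i => (memLp_conv (continuous_kernel a) hks _).1
  have hN : ∀ i, l2 (ψ i) ≤ ‖V‖ := fun i => by
    refine (memLp_conv (continuous_kernel a) hks _).2.trans ?_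
    rw [integral_abs_kernel ha, one_mul]
    exact norm_coord_le i V
  have hfd : ∀ i j, (fun x => fderiv ℝ (ψ i) x (e j))
      = conv (fun x => fderiv ℝ (kernel a) x (e j)) (coord i V) := fun i j => by
    ext x
    exact fderiv_conv (contDiff_kernel a) hks _ x (e j)
  have hgr := fun i j => memLp_conv (contDiff_fderiv_apply (contDiff_kernel a) (e j)).continuous
    (hasCompactSupport_fderiv_apply hks (e j)) (coord i V)
  have hψ' : ∀ i j, MemLp (fun x => fderiv ℝ (ψ i) x (e j)) 2 volume := fun i j => by
    rw [hfd]
    exact (hgr i j).1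
  have hG : ∀ i j, l2 (fun x => fderiv ℝ (ψ i) x (e j)) ≤ a⁻¹ * bumpVar * ‖V‖ := fun i j => by
    rw [hfd]
    refine (hgr i j).2.trans ?_
    rw [integral_abs_fderiv_kernel ha]
    have h1 : ∫ x, |fderiv ℝ bump x (e j)| ≤ bumpVar :=
      Finset.single_le_sum (f := fun j => ∫ x, |fderiv ℝ bump x (e j)|)
        (fun _ _ => integral_nonneg fun _ => abs_nonneg _) (Finset.mem_univ j)
    have h0 : 0 ≤ ∫ x, |fderiv ℝ bump x (e j)| := integral_nonneg fun _ => abs_nonneg _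
    have h2 := bumpVar_nonneg
    gcongr
    exact norm_coord_le i V
  have hM : ∀ n i x, |(truncate n ψ hψ).toFun i x| ≤ l2 (kernel a) * ‖V‖ := fun n i x => by
    change |cutoff n x * ψ i x| ≤ _
    rw [abs_mul]
    refine (mul_le_of_le_one_left (abs_nonneg _) (abs_cutoff_le n x)).trans ?_
    refine (abs_conv_le (continuous_kernel a) hks _ x).trans ?_
    exact mul_le_mul_of_nonneg_left (norm_coord_le i V) (l2_nonneg _)
  have hae : ∀ᵐ t, ∀ n : ℕ, t ∈ Ioo 0 (S - h) →
      |pair (u (t + h)) (truncate n ψ hψ).val - pair (u t) (truncate n ψ hψ).val|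
      ≤ B * (3 * (L * ((n : ℝ) + 1)⁻¹ * ‖V‖)) * h
        + (3 * (a⁻¹ * bumpVar * ‖V‖ + L * ((n : ℝ) + 1)⁻¹ * ‖V‖)
          + 5 * (A * (l2 (kernel a) * ‖V‖))) * ∫ s in Ioo t (t + h), ∑ j, ‖Du j s‖ :=
    ae_all_iff.2 fun n => hs.abs_pair_sub_le hε (truncate n ψ hψ) hh hu hp (hM n)
      (norm_grad_truncate_le hL hψ hψ2 hψ' hG hN n)
      (norm_div_truncate_le hL hψ hψ2
        (sum_fderiv_conv_eq_zero hV (contDiff_kernel a) hks) hN n)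
  filter_upwards [hae] with t ht htm
  have hΦ : ∀ i, smooth ha i V =ᵐ[volume] ψ i := fun i =>
    coeFn_mollify (kernel a) (continuous_kernel a) hks (coord i V)
  have hl := ((tendsto_pair_truncate hψ hΦ (u (t + h))).sub
    (tendsto_pair_truncate hψ hΦ (u t))).abs
  -- Letting the cutoff radius tend to infinity, with `B` fixed, kills both the pressure term and
  -- the cutoff correction to the gradient.
  refine le_of_tendsto_of_tendsto' hl ?_ fun n => ht n htm
  have hz := tendsto_inv_nat_add_one
  have h1 : Tendsto (fun n : ℕ => L * ((n : ℝ) + 1)⁻¹ * ‖V‖) atTop (𝓝 0) := by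
    simpa using (hz.const_mul L).mul_const ‖V‖
  have h2 := (((h1.const_mul 3).const_mul B).mul_const h).add
    ((((h1.const_add (a⁻¹ * bumpVar * ‖V‖)).const_mul 3).add_const
      (5 * (A * (l2 (kernel a) * ‖V‖)))).mul_const (∫ s in Ioo t (t + h), ∑ j, ‖Du j s‖))
  simpa using h2

end IsWeakSolutionWith

/-! ### The Leray projector and the splitting of the squared norm -/

lemma lerayP_mem (w : L2Vec) : lerayP w ∈ solenoidal :=
  Submodule.starProjection_apply_mem _ _

lemma norm_lerayP_le (w : L2Vec) : ‖lerayP w‖ ≤ ‖w‖ :=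
  Submodule.norm_starProjection_apply_le _ _

lemma norm_lerayP_sq (w : L2Vec) : ‖lerayP w‖ ^ 2 = inner ℝ w (lerayP w) := by
  have h : inner ℝ (w - lerayP w) (lerayP w) = 0 :=
    solenoidal.starProjection_inner_eq_zero w _ (lerayP_mem w)
  rw [inner_sub_left, real_inner_self_eq_norm_sq] at h
  linarith

lemma pair_sub (U U' : L2Vec) (Φ : Fin 3 → L2Scal) : pair (U - U') Φ = pair U Φ - pair U' Φ := by
  simp [pair, inner_sub_left, Finset.sum_sub_distrib]

lemma HasWeakPartial.sub {j : Fin 3} {f f' g g' : L2Vec} (h : HasWeakPartial j f g)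
    (h' : HasWeakPartial j f' g') : HasWeakPartial j (f - f') (g - g') := by
  intro φ hφ hc
  have key : ∀ (k : Space → ℝ) (v v' : L2Vec), Continuous k → HasCompactSupport k →
      ∫ x, k x • (v - v' : L2Vec) x = (∫ x, k x • v x) - ∫ x, k x • v' x := by
    intro k v v' hk hkc
    have hi : ∀ v : L2Vec, Integrable (fun x => k x • v x) volume := fun v =>
      ((Lp.memLp v).locallyIntegrable (by norm_num)).integrable_smul_left_of_hasCompactSupport hk hkc
    rw [← integral_sub (hi v) (hi v')]
    apply integral_congr_ae
    filter_upwards [Lp.coeFn_sub v v'] with x hx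
    rw [hx, Pi.sub_apply, smul_sub]
  rw [key _ f f' (contDiff_fderiv_apply hφ (e j)).continuous (hasCompactSupport_fderiv_apply hc _),
    key _ g g' hφ.continuous hc, h φ hφ hc, h' φ hφ hc]
  abel

lemma inner_sub_smooth_le {a : ℝ} (ha : 0 < a) {z V : L2Vec} {d : Fin 3 → L2Vec}
    (hd : ∀ j, HasWeakPartial j z (d j)) (hV : ‖V‖ ≤ ‖z‖) (i : Fin 3) :
    inner ℝ (coord i z) (coord i V - smooth ha i V) ≤ a * ((∑ j, ‖d j‖) * ‖z‖) := by
  have h1 := (le_abs_self _).trans (abs_inner_sub_mollify_le ha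
    (fun j => hasWeakPartial_coord (hd j) i) (coord i V))
  have h2 : ‖coord i V‖ ≤ ‖z‖ := (norm_coord_le _ _).trans hV
  have h3 : ∑ j, ‖coord i (d j)‖ ≤ ∑ j, ‖d j‖ :=
    Finset.sum_le_sum fun j _ => norm_coord_le _ _
  refine h1.trans (mul_le_mul_of_nonneg_left ?_ ha.le)
  exact mul_le_mul h3 h2 (norm_nonneg _) (Finset.sum_nonneg fun j _ => norm_nonneg _)

/-- A projected field is controlled by its mollified pairing and a commutator term. -/
lemma norm_sq_le_abs_pair_add {a : ℝ} (ha : 0 < a) {z V : L2Vec} {d : Fin 3 → L2Vec}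
    (hd : ∀ j, HasWeakPartial j z (d j)) (hV : ‖V‖ ≤ ‖z‖) (hzV : ‖V‖ ^ 2 = inner ℝ z V) :
    ‖V‖ ^ 2 ≤ |pair z (fun i => smooth ha i V)| + 3 * a * ((∑ j, ‖d j‖) * ‖z‖) := by
  have h3 : ‖V‖ ^ 2 = pair z (fun i => smooth ha i V)
      + ∑ i, inner ℝ (coord i z) (coord i V - smooth ha i V) := by
    rw [hzV, inner_eq_sum_coord, pair, ← Finset.sum_add_distrib]
    refine Finset.sum_congr rfl fun i _ => ?_
    rw [inner_sub_right, add_sub_cancel]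
  rw [h3, Fin.sum_univ_three]
  have h0 := inner_sub_smooth_le ha hd hV 0
  have h1 := inner_sub_smooth_le ha hd hV 1
  have h2 := inner_sub_smooth_le ha hd hV 2
  have h4 := le_abs_self (pair z (fun i => smooth ha i V))
  linarith

lemma continuous_pair_smooth {a : ℝ} (ha : 0 < a) (z : L2Vec) :
    Continuous fun V : L2Vec => pair z (fun i => smooth ha i V) :=
  continuous_finsetSum _ fun i _ => continuous_const.inner (smooth ha i).continuous

instance : TopologicalSpace.SeparableSpace L2Vec :=
  haveI : Fact ((2 : ℝ≥0∞) ≠ ⊤) := ⟨by norm_num⟩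
  inferInstance

/-- After Fubini with `ζ` the indicator of `(0, T)`, each `D s` is weighted by the length of a
window, at most `h`. This is the source of the factor `h`. -/
lemma integral_window_le {D : ℝ → ℝ} (hD : Integrable D) (hD0 : ∀ s, 0 ≤ D s) {T h : ℝ}
    (hh : 0 < h) : ∫ t in Ioo 0 T, ∫ s in t..(t + h), D s ≤ h * ∫ s, D s := by
  set ζ : ℝ → ℝ := (Ioo 0 T).indicator 1
  have hζ : Integrable ζ := (integrable_indicator_iff measurableSet_Ioo).2
    (integrableOn_const (by simp))
  have hζ0 : ∀ t, 0 ≤ ζ t := fun t => indicator_nonneg (fun _ _ => zero_le_one) t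
  have hζ1 : ∀ t, ζ t ≤ 1 := fun t => indicator_le_self' (fun _ _ => zero_le_one) t
  have h1 : ∫ t in Ioo 0 T, ∫ s in t..(t + h), D s = ∫ t, ζ t * ∫ s in t..(t + h), D s := by
    rw [← integral_indicator measurableSet_Ioo]
    congr 1 with t
    by_cases ht : t ∈ Ioo 0 T
    · simp [ζ, indicator_of_mem ht]
    · simp [ζ, indicator_of_notMem ht]
  have hw : ∀ s, 0 ≤ ∫ t in (s - h)..s, ζ t := fun s =>
    intervalIntegral.integral_nonneg (by linarith) fun t _ => hζ0 t
  rw [h1, ← integral_mul_window_eq hζ hD hh, ← integral_const_mul]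
  refine integral_mono_of_nonneg (Eventually.of_forall fun s => mul_nonneg (hw s) (hD0 s))
    (hD.const_mul h) (Eventually.of_forall fun s => mul_le_mul_of_nonneg_right ?_ (hD0 s))
  calc ∫ t in (s - h)..s, ζ t ≤ ∫ t in (s - h)..s, (1 : ℝ) :=
        intervalIntegral.integral_mono_on (by linarith) hζ.intervalIntegrable (by simp)
          fun t _ => hζ1 t
    _ = h := by simp

/-! ### Energy bounds and the integrated estimate -/

namespace IsWeakSolutionWith

variable {S ε : ℝ} {u₀ : L2Vec} {θ₀ p₀ : L2Scal} {u : ℝ → L2Vec} {θ p : ℝ → L2Scal}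
  {Du : Fin 3 → ℝ → L2Vec} {Dθ : Fin 3 → ℝ → L2Scal}

lemma integrableOn_Du_sq (hs : IsWeakSolutionWith S ε u₀ θ₀ p₀ u θ p Du Dθ) :
    IntegrableOn (fun s => ∑ j, ‖Du j s‖ ^ 2) (Ioo 0 S) :=
  integrable_finsetSum _ fun j _ => (hs.Du_mem j).norm.integrable_sq

lemma integrableOn_Dθ_sq (hs : IsWeakSolutionWith S ε u₀ θ₀ p₀ u θ p Du Dθ) :
    IntegrableOn (fun s => ∑ j, ‖Dθ j s‖ ^ 2) (Ioo 0 S) :=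
  integrable_finsetSum _ fun j _ => (hs.Dθ_mem j).norm.integrable_sq

lemma energy_bounds (hs : IsWeakSolutionWith S ε u₀ θ₀ p₀ u θ p Du Dθ) (hε : 0 < ε) {E : ℝ}
    (hE : 1 / 2 * ‖u₀‖ ^ 2 + 1 / 2 * ‖θ₀‖ ^ 2 + ε / 2 * ‖p₀‖ ^ 2 ≤ E) :
    ∀ᵐ t, t ∈ Ioo 0 S → ‖u t‖ ≤ √(2 * E) ∧ ‖p t‖ ≤ √(2 * E / ε)
      ∧ ∫ s in Ioo 0 t, ∑ j, ‖Du j s‖ ^ 2 ≤ E := by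
  filter_upwards [(ae_restrict_iff' measurableSet_Ioo).1 hs.energy] with t ht htm
  have h := (ht htm).trans hE
  have hsub : Ioo 0 t ⊆ Ioo 0 S := Ioo_subset_Ioo_right htm.2.le
  rw [integral_add (hs.integrableOn_Du_sq.mono_set hsub) (hs.integrableOn_Dθ_sq.mono_set hsub)] at h
  have h1 : 0 ≤ ∫ s in Ioo 0 t, ∑ j, ‖Du j s‖ ^ 2 :=
    integral_nonneg fun s => Finset.sum_nonneg fun j _ => by positivity
  have h2 : 0 ≤ ∫ s in Ioo 0 t, ∑ j, ‖Dθ j s‖ ^ 2 :=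
    integral_nonneg fun s => Finset.sum_nonneg fun j _ => by positivity
  have h3 : 0 ≤ ‖u t‖ ^ 2 := by positivity
  have h4 : 0 ≤ ‖θ t‖ ^ 2 := by positivity
  have h5 : 0 ≤ ε / 2 * ‖p t‖ ^ 2 := by positivity
  refine ⟨Real.le_sqrt_of_sq_le (by linarith), Real.le_sqrt_of_sq_le ?_, by linarith⟩
  rw [le_div_iff₀ hε]
  linarith

/-- The energy inequality holds only for almost every `t < S`; such times are dense in `(0, S)` and
the dissipation is continuous in its upper limit, so the bound passes to `t = S`. -/
lemma integral_Du_sq_le (hs : IsWeakSolutionWith S ε u₀ θ₀ p₀ u θ p Du Dθ) (hε : 0 < ε) {E : ℝ}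
    (hE : 1 / 2 * ‖u₀‖ ^ 2 + 1 / 2 * ‖θ₀‖ ^ 2 + ε / 2 * ‖p₀‖ ^ 2 ≤ E) (hS : 0 < S) :
    ∫ s in Ioo 0 S, ∑ j, ‖Du j s‖ ^ 2 ≤ E := by
  set g : ℝ → ℝ := fun s => ∑ j, ‖Du j s‖ ^ 2 with hg
  have hgi : Integrable ((Ioo 0 S).indicator g) :=
    hs.integrableOn_Du_sq.integrable_indicator measurableSet_Ioo
  have hF : Continuous fun t => ∫ s in (0 : ℝ)..t, (Ioo 0 S).indicator g s :=
    intervalIntegral.continuous_primitive (fun _ _ => hgi.intervalIntegrable) 0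
  have heq : ∀ t ∈ Ioc 0 S, ∫ s in (0 : ℝ)..t, (Ioo 0 S).indicator g s = ∫ s in Ioo 0 t, g s := by
    intro t ht
    rw [intervalIntegral.integral_of_le ht.1.le, integral_Ioc_eq_integral_Ioo]
    exact setIntegral_congr_fun measurableSet_Ioo fun s hs =>
      indicator_of_mem (s := Ioo 0 S) ⟨hs.1, hs.2.trans_le ht.2⟩ _
  have hd := Measure.dense_of_ae (hs.energy_bounds hε hE)
  have hcl : closure (Ioo 0 S ∩ {t | t ∈ Ioo 0 S → ‖u t‖ ≤ √(2 * E) ∧ ‖p t‖ ≤ √(2 * E / ε)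
      ∧ ∫ s in Ioo 0 t, ∑ j, ‖Du j s‖ ^ 2 ≤ E})
      ⊆ {t | ∫ s in (0 : ℝ)..t, (Ioo 0 S).indicator g s ≤ E} := by
    refine closure_minimal ?_ (isClosed_le hF continuous_const)
    rintro t ⟨h1, h2⟩
    rw [mem_ofPred_eq, heq t ⟨h1.1, h1.2.le⟩]
    exact (h2 h1).2.2
  have hS' : S ∈ closure (Ioo 0 S) := by
    rw [closure_Ioo hS.ne]
    exact ⟨hS.le, le_rfl⟩
  have h := hcl (closure_minimal (hd.open_subset_closure_inter isOpen_Ioo) isClosed_closure hS')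
  rw [mem_ofPred_eq, heq S ⟨hS, le_rfl⟩] at h
  exact h

/-- From `x ≤ 1 + x²` for each of the three derivatives. An `L¹` bound in time suffices, since the
other factor `‖u‖` is bounded uniformly in time. -/
lemma integral_Du_le (hs : IsWeakSolutionWith S ε u₀ θ₀ p₀ u θ p Du Dθ) (hε : 0 < ε) {E : ℝ}
    (hE : 1 / 2 * ‖u₀‖ ^ 2 + 1 / 2 * ‖θ₀‖ ^ 2 + ε / 2 * ‖p₀‖ ^ 2 ≤ E) {R : ℝ} (hR : 0 < R)
    (hRS : R ≤ S) : ∫ s in Ioo 0 R, ∑ j, ‖Du j s‖ ≤ 3 * R + E := by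
  have hsub : Ioo 0 R ⊆ Ioo 0 S := Ioo_subset_Ioo_right hRS
  have hi := hs.integrableOn_Du_sq.mono_set hsub
  have hc : Integrable (fun _ => (3 : ℝ)) (volume.restrict (Ioo 0 R)) :=
    integrableOn_const (by simp)
  calc ∫ s in Ioo 0 R, ∑ j, ‖Du j s‖ ≤ ∫ s in Ioo 0 R, (3 + ∑ j, ‖Du j s‖ ^ 2) := by
        refine integral_mono (hs.integrableOn_Du.mono_set hsub) (hc.add hi) fun s => ?_
        simp only [Fin.sum_univ_three]
        nlinarith [sq_nonneg (‖Du 0 s‖ - 1), sq_nonneg (‖Du 1 s‖ - 1), sq_nonneg (‖Du 2 s‖ - 1)]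
    _ = 3 * R + ∫ s in Ioo 0 R, ∑ j, ‖Du j s‖ ^ 2 := by
        rw [integral_add hc hi, setIntegral_const, Real.volume_real_Ioo_of_le hR.le, sub_zero,
          smul_eq_mul, mul_comm]
    _ ≤ 3 * R + ∫ s in Ioo 0 S, ∑ j, ‖Du j s‖ ^ 2 := by
        refine add_le_add le_rfl ?_
        exact setIntegral_mono_set hs.integrableOn_Du_sq
          (Eventually.of_forall fun s => Finset.sum_nonneg fun j _ => by positivity)
          hsub.eventuallyLE
    _ ≤ 3 * R + E := by
        gcongr
        exact hs.integral_Du_sq_le hε hE (hR.trans_le hRS)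

lemma ae_abs_pair_le (hs : IsWeakSolutionWith S ε u₀ θ₀ p₀ u θ p Du Dθ) (hε : 0 < ε)
    {a : ℝ} (ha : 0 < a) {h : ℝ} (hh : 0 < h) {A B : ℝ} (hA : 0 ≤ A)
    (hu : ∀ᵐ t ∂(volume.restrict (Ioo 0 S)), ‖u t‖ ≤ A)
    (hp : ∀ᵐ t ∂(volume.restrict (Ioo 0 S)), ‖p t‖ ≤ B) :
    ∀ᵐ t, t ∈ Ioo 0 (S - h) → ∀ w : L2Vec,
      |pair (u (t + h) - u t) (fun i => smooth ha i (lerayP w))|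
      ≤ (3 * (a⁻¹ * bumpVar) + 5 * (A * l2 (kernel a))) * ‖w‖
        * ∫ s in Ioo t (t + h), ∑ j, ‖Du j s‖ := by
  -- A countable dense family of fields gives a single null set of times; continuity in `w` then
  -- covers all `w`, in particular the increment at time `t` itself.
  have hae := ae_all_iff.2 fun n => hs.abs_pair_smooth_sub_le hε
    (lerayP_mem (TopologicalSpace.denseSeq L2Vec n)) ha hh hu hp
  filter_upwards [hae] with t ht htm
  have hI : 0 ≤ ∫ s in Ioo t (t + h), ∑ j, ‖Du j s‖ :=
    integral_nonneg fun s => Finset.sum_nonneg fun j _ => norm_nonneg _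
  have hcl : IsClosed {w : L2Vec | |pair (u (t + h) - u t) (fun i => smooth ha i (lerayP w))|
      ≤ (3 * (a⁻¹ * bumpVar) + 5 * (A * l2 (kernel a))) * ‖w‖
        * ∫ s in Ioo t (t + h), ∑ j, ‖Du j s‖} := by
    refine isClosed_le ((continuous_pair_smooth ha _).comp lerayP.continuous).abs ?_
    exact (continuous_const.mul continuous_norm).mul continuous_const
  refine fun w => hcl.closure_subset_iff.2 ?_ (TopologicalSpace.denseRange_denseSeq L2Vec w)
  rintro _ ⟨n, rfl⟩
  rw [mem_ofPred_eq, pair_sub]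
  refine (ht n htm).trans (mul_le_mul_of_nonneg_right ?_ hI)
  have hn := norm_lerayP_le (TopologicalSpace.denseSeq L2Vec n)
  have hb := bumpVar_nonneg
  have hk := l2_nonneg (kernel a)
  calc _ = (3 * (a⁻¹ * bumpVar) + 5 * (A * l2 (kernel a)))
        * ‖lerayP (TopologicalSpace.denseSeq L2Vec n)‖ := by ring
    _ ≤ _ := mul_le_mul_of_nonneg_left hn (by positivity)

lemma ae_norm_lerayP_sq_le (hs : IsWeakSolutionWith S ε u₀ θ₀ p₀ u θ p Du Dθ) (hε : 0 < ε)
    {a : ℝ} (ha : 0 < a) {h : ℝ} (hh : 0 < h) {A B : ℝ} (hA : 0 ≤ A)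
    (hu : ∀ᵐ t ∂(volume.restrict (Ioo 0 S)), ‖u t‖ ≤ A)
    (hp : ∀ᵐ t ∂(volume.restrict (Ioo 0 S)), ‖p t‖ ≤ B) :
    ∀ᵐ t, t ∈ Ioo 0 (S - h) → ‖lerayP (u (t + h)) - lerayP (u t)‖ ^ 2
      ≤ 2 * A * ((3 * (a⁻¹ * bumpVar) + 5 * (A * l2 (kernel a)))
          * (∫ s in Ioo t (t + h), ∑ j, ‖Du j s‖)
        + 3 * a * (∑ j, ‖Du j (t + h)‖ + ∑ j, ‖Du j t‖)) := by
  -- Almost everywhere properties are also needed at time `t + h`; translation preserves null sets.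
  have hq := (measurePreserving_add_right (volume : Measure ℝ) h).quasiMeasurePreserving
  have hw := (ae_restrict_iff' measurableSet_Ioo).1 (ae_all_iff.2 hs.Du_weak)
  have hu' := (ae_restrict_iff' measurableSet_Ioo).1 hu
  filter_upwards [hs.ae_abs_pair_le hε ha hh hA hu hp, hw, hq.ae hw, hu', hq.ae hu'] with
    t h1 h2 h3 h4 h5 htm
  have m1 : t ∈ Ioo 0 S := ⟨htm.1, by linarith [htm.2]⟩
  have m2 : t + h ∈ Ioo 0 S := ⟨by linarith [htm.1], by linarith [htm.2]⟩
  have hz : ‖u (t + h) - u t‖ ≤ 2 * A := (norm_sub_le _ _).trans (by linarith [h4 m1, h5 m2])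
  have hI : 0 ≤ ∫ s in Ioo t (t + h), ∑ j, ‖Du j s‖ :=
    integral_nonneg fun s => Finset.sum_nonneg fun j _ => norm_nonneg _
  have hd : ∑ j, ‖Du j (t + h) - Du j t‖ ≤ ∑ j, ‖Du j (t + h)‖ + ∑ j, ‖Du j t‖ := by
    rw [← Finset.sum_add_distrib]
    exact Finset.sum_le_sum fun j _ => norm_sub_le _ _
  have hd0 : 0 ≤ ∑ j, ‖Du j (t + h) - Du j t‖ := Finset.sum_nonneg fun j _ => norm_nonneg _
  have hb := bumpVar_nonneg
  have hk := l2_nonneg (kernel a)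
  have hc : 0 ≤ 3 * (a⁻¹ * bumpVar) + 5 * (A * l2 (kernel a)) := by positivity
  have key := norm_sq_le_abs_pair_add ha (fun j => (h3 m2 j).sub (h2 m1 j)) (norm_lerayP_le _)
    (norm_lerayP_sq _)
  have e1 := (h1 htm (u (t + h) - u t)).trans
    (mul_le_mul_of_nonneg_right (mul_le_mul_of_nonneg_left hz hc) hI)
  have e2 := mul_le_mul hd hz (norm_nonneg _) (hd0.trans hd)
  have e3 := mul_le_mul_of_nonneg_left e2 (by positivity : 0 ≤ 3 * a)
  rw [← map_sub]
  refine (key.trans (add_le_add e1 e3)).trans_eq ?_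
  ring

/-- The factor `6 * a` is `3 * a` counted twice, for the gradients at `t` and at `t + h`, each of
whose time integrals is at most the integral over `(0, T + h)`. -/
lemma lintegral_lerayP_le (hs : IsWeakSolutionWith S ε u₀ θ₀ p₀ u θ p Du Dθ) (hε : 0 < ε)
    {a : ℝ} (ha : 0 < a) {T h : ℝ} (hT : 0 < T) (hh : 0 < h) (hS : T + h ≤ S) {E : ℝ}
    (hE : 1 / 2 * ‖u₀‖ ^ 2 + 1 / 2 * ‖θ₀‖ ^ 2 + ε / 2 * ‖p₀‖ ^ 2 ≤ E) :
    ∫⁻ t in Icc 0 T, ‖lerayP (u (t + h)) - lerayP (u t)‖ₑ ^ 2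
      ≤ ENNReal.ofReal (2 * √(2 * E) * (((3 * (a⁻¹ * bumpVar) + 5 * (√(2 * E) * l2 (kernel a))) * h
        + 6 * a) * (3 * (T + h) + E))) := by
  set A := √(2 * E)
  have hA : 0 ≤ A := Real.sqrt_nonneg _
  set c := 3 * (a⁻¹ * bumpVar) + 5 * (A * l2 (kernel a)) with hc
  have hc0 : 0 ≤ c := by
    have hb := bumpVar_nonneg
    have hk := l2_nonneg (kernel a)
    positivity
  have hen := hs.energy_bounds hε hE
  have hu : ∀ᵐ t ∂(volume.restrict (Ioo 0 S)), ‖u t‖ ≤ A :=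
    (ae_restrict_iff' measurableSet_Ioo).2 (hen.mono fun t ht htm => (ht htm).1)
  have hp : ∀ᵐ t ∂(volume.restrict (Ioo 0 S)), ‖p t‖ ≤ √(2 * E / ε) :=
    (ae_restrict_iff' measurableSet_Ioo).2 (hen.mono fun t ht htm => (ht htm).2.1)
  -- Extension by zero makes the gradient norm integrable on the whole line, as the window and
  -- translation arguments require.
  set D : ℝ → ℝ := (Ioo 0 (T + h)).indicator fun s => ∑ j, ‖Du j s‖ with hD
  have hDi : Integrable D :=
    (hs.integrableOn_Du.mono_set (Ioo_subset_Ioo_right hS)).integrable_indicator measurableSet_Ioo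
  have hD0 : ∀ s, 0 ≤ D s := fun s =>
    indicator_nonneg (fun s _ => Finset.sum_nonneg fun j _ => norm_nonneg _) s
  have hJ : ∫ s, D s ≤ 3 * (T + h) + E := by
    rw [hD, integral_indicator measurableSet_Ioo]
    exact hs.integral_Du_le hε hE (by linarith) hS
  have hW : Continuous (fun t => ∫ s in t..(t + h), D s) := by
    have : (fun t => ∫ s in t..(t + h), D s)
        = fun t => (∫ s in (0 : ℝ)..(t + h), D s) - ∫ s in (0 : ℝ)..t, D s := by
      ext t
      rw [intervalIntegral.integral_interval_sub_left hDi.intervalIntegrable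
        hDi.intervalIntegrable]
    rw [this]
    have hc := intervalIntegral.continuous_primitive (fun _ _ => hDi.intervalIntegrable) (0 : ℝ)
    exact (hc.comp (continuous_id.add continuous_const)).sub hc
  have hWi : IntegrableOn (fun t => ∫ s in t..(t + h), D s) (Ioo 0 T) :=
    (hW.integrableOn_Icc).mono_set Ioo_subset_Icc_self
  have hDh : Integrable (fun t => D (t + h)) := hDi.comp_add_right h
  have hDD : Integrable (fun t => D (t + h) + D t) (volume.restrict (Ioo 0 T)) :=
    (hDh.add hDi).integrableOn
  have hFi : IntegrableOn (fun t => 2 * A * (c * (∫ s in t..(t + h), D s)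
      + 3 * a * (D (t + h) + D t))) (Ioo 0 T) :=
    ((hWi.const_mul c).add (hDD.const_mul (3 * a))).const_mul (2 * A)
  have hW0 : ∀ t, 0 ≤ ∫ s in t..(t + h), D s := fun t =>
    intervalIntegral.integral_nonneg (by linarith) fun s _ => hD0 s
  rw [← restrict_Ioo_eq_restrict_Icc]
  calc ∫⁻ t in Ioo 0 T, ‖lerayP (u (t + h)) - lerayP (u t)‖ₑ ^ 2
      ≤ ∫⁻ t in Ioo 0 T, ENNReal.ofReal (2 * A * (c * (∫ s in t..(t + h), D s)
        + 3 * a * (D (t + h) + D t))) := by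
        refine lintegral_mono_ae ((ae_restrict_iff' measurableSet_Ioo).2 ?_)
        filter_upwards [hs.ae_norm_lerayP_sq_le hε ha hh hA hu hp] with t ht htm
        have h1 : D t = ∑ j, ‖Du j t‖ :=
          indicator_of_mem (s := Ioo 0 (T + h)) ⟨htm.1, by linarith [htm.2]⟩ _
        have h2 : D (t + h) = ∑ j, ‖Du j (t + h)‖ :=
          indicator_of_mem (s := Ioo 0 (T + h)) ⟨by linarith [htm.1], by linarith [htm.2]⟩ _
        have h3 : ∫ s in t..(t + h), D s = ∫ s in Ioo t (t + h), ∑ j, ‖Du j s‖ := by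
          rw [intervalIntegral.integral_of_le (by linarith), integral_Ioc_eq_integral_Ioo]
          exact setIntegral_congr_fun measurableSet_Ioo fun s hs => indicator_of_mem
            (s := Ioo 0 (T + h)) ⟨by linarith [hs.1, htm.1], by linarith [hs.2, htm.2]⟩ _
        rw [h1, h2, h3, ← ofReal_norm, ← ENNReal.ofReal_pow (norm_nonneg _)]
        exact ENNReal.ofReal_le_ofReal (ht ⟨htm.1, by linarith [htm.2]⟩)
    _ = ENNReal.ofReal (∫ t in Ioo 0 T, 2 * A * (c * (∫ s in t..(t + h), D s)
        + 3 * a * (D (t + h) + D t))) := by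
        refine (ofReal_integral_eq_lintegral_ofReal hFi (Eventually.of_forall fun t => ?_)).symm
        have := hW0 t
        have := hD0 t
        have := hD0 (t + h)
        simp only [Pi.zero_apply]
        positivity
    _ ≤ _ := by
        refine ENNReal.ofReal_le_ofReal ?_
        rw [integral_const_mul, integral_add (hWi.const_mul c) (hDD.const_mul (3 * a)),
          integral_const_mul, integral_const_mul,
          integral_add hDh.integrableOn hDi.integrableOn]
        have e1 := integral_window_le hDi hD0 (T := T) hh
        have e2 : ∫ t in Ioo 0 T, D t ≤ ∫ t, D t :=
          setIntegral_le_integral hDi (Eventually.of_forall hD0)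
        have e3 : ∫ t in Ioo 0 T, D (t + h) ≤ ∫ t, D t :=
          (setIntegral_le_integral hDh (Eventually.of_forall fun t => hD0 _)).trans_eq
            (integral_add_right_eq_self D h)
        gcongr
        calc _ ≤ c * (h * ∫ s, D s) + 3 * a * ((∫ s, D s) + ∫ s, D s) := by gcongr
          _ = (c * h + 6 * a) * ∫ s, D s := by ring
          _ ≤ _ := by gcongr

end IsWeakSolutionWith

/-! ### Uniform constants and the choice of scale -/

lemma exists_energy_bound {ε : ℕ → ℝ} (hε : ∀ n, 0 < ε n) {u₀ : ℕ → L2Vec} {θ₀ p₀ : ℕ → L2Scal}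
    {u₀lim : L2Vec} {θ₀lim : L2Scal} (hID : InitialDataConverge ε u₀ θ₀ p₀ u₀lim θ₀lim) :
    ∃ E : ℝ, 0 ≤ E ∧ ∀ n,
      1 / 2 * ‖u₀ n‖ ^ 2 + 1 / 2 * ‖θ₀ n‖ ^ 2 + ε n / 2 * ‖p₀ n‖ ^ 2 ≤ E := by
  have h := ((hID.velocity.norm.pow 2).const_mul (1 / 2)).add
    ((hID.temperature.norm.pow 2).const_mul (1 / 2)) |>.add
    ((hID.pressure.norm.pow 2).const_mul (1 / 2))
  obtain ⟨E, hE⟩ := h.bddAbove_range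
  have hn : ∀ n, 1 / 2 * ‖u₀ n‖ ^ 2 + 1 / 2 * ‖θ₀ n‖ ^ 2 + ε n / 2 * ‖p₀ n‖ ^ 2 ≤ E := by
    intro n
    refine le_trans (le_of_eq ?_) (hE ⟨n, rfl⟩)
    simp only [norm_smul, Real.norm_eq_abs, abs_of_nonneg (Real.sqrt_nonneg _), mul_pow,
      Real.sq_sqrt (hε n).le]
    ring
  have h0 := (hε 0).le
  exact ⟨E, le_trans (by positivity) (hn 0), hn⟩

/-- The choice `a = h^{2/5}` of the mollification scale. -/
lemma scale_bound {h A b β : ℝ} (hh : h ∈ Ioo (0 : ℝ) 1) (hb : 0 ≤ b) :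
    (3 * ((h ^ (2 / 5 : ℝ))⁻¹ * b) + 5 * (A * ((h ^ (2 / 5 : ℝ)) ^ (-(3 / 2) : ℝ) * β))) * h
      + 6 * h ^ (2 / 5 : ℝ) ≤ h ^ (2 / 5 : ℝ) * (3 * b + 5 * (A * β) + 6) := by
  have h0 := hh.1
  -- Diffusion gives `h^{3/5}`, better than needed because `h < 1`; the convective term below gives
  -- exactly `h^{2/5}` and so balances the commutator term.
  have e1 : (h ^ (2 / 5 : ℝ))⁻¹ * h ≤ h ^ (2 / 5 : ℝ) := by
    rw [← Real.rpow_neg h0.le]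
    nth_rw 2 [← Real.rpow_one h]
    rw [← Real.rpow_add h0]
    exact Real.rpow_le_rpow_of_exponent_ge h0 hh.2.le (by norm_num)
  have e2 : (h ^ (2 / 5 : ℝ)) ^ (-(3 / 2) : ℝ) * h = h ^ (2 / 5 : ℝ) := by
    rw [← Real.rpow_mul h0.le]
    nth_rw 2 [← Real.rpow_one h]
    rw [← Real.rpow_add h0]
    norm_num
  have e3 := mul_le_mul_of_nonneg_right e1 hb
  have e4 : (h ^ (2 / 5 : ℝ)) ^ (-(3 / 2) : ℝ) * h * (A * β) = h ^ (2 / 5 : ℝ) * (A * β) := by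
    rw [e2]
  linarith

end NSF

theorem mainTheorem5
    (ε : ℕ → ℝ) (hε : ∀ n, 0 < ε n) (hε_lim : Tendsto ε atTop (𝓝 0))
    (u₀ : ℕ → NSF.L2Vec) (θ₀ p₀ : ℕ → NSF.L2Scal)
    (u₀lim : NSF.L2Vec) (θ₀lim : NSF.L2Scal)
    (hID : NSF.InitialDataConverge ε u₀ θ₀ p₀ u₀lim θ₀lim)
    (T : ℝ) (hT : 0 < T) :
    ∃ C : ℝ, ∀ (n : ℕ) (S : ℝ) (u : ℝ → NSF.L2Vec) (θ p : ℝ → NSF.L2Scal),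
      NSF.IsWeakSolution S (ε n) (u₀ n) (θ₀ n) (p₀ n) u θ p →
      ∀ h ∈ Ioo (0 : ℝ) 1, T + h ≤ S →
        eLpNorm (fun t => NSF.lerayP (u (t + h)) - NSF.lerayP (u t)) 2
            (volume.restrict (Icc 0 T))
          ≤ ENNReal.ofReal (C * h ^ (1 / 5 : ℝ)) := by
  obtain ⟨E, hE0, hE⟩ := NSF.exists_energy_bound hε hID
  -- The bound of `lintegral_lerayP_le` at `a = h^{2/5}` with the factor `h^{2/5}` taken out; `T +
  -- 1` replaces `T + h`.
  set K := 2 * √(2 * E) * ((3 * NSF.bumpVar + 5 * (√(2 * E) * NSF.l2 NSF.bump) + 6)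
    * (3 * (T + 1) + E)) with hK
  have hb := NSF.bumpVar_nonneg
  have hβ := NSF.l2_nonneg NSF.bump
  have hA := Real.sqrt_nonneg (2 * E)
  have hK0 : 0 ≤ K := by positivity
  refine ⟨√K, ?_⟩
  rintro n S u θ p ⟨Du, Dθ, hs⟩ h hh hS
  have h0 := hh.1
  have ha : 0 < h ^ (2 / 5 : ℝ) := Real.rpow_pos_of_pos h0 _
  have hmain := hs.lintegral_lerayP_le (hε n) ha hT h0 hS (hE n)
  have hle : ∫⁻ t in Icc 0 T, ‖NSF.lerayP (u (t + h)) - NSF.lerayP (u t)‖ₑ ^ 2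
      ≤ ENNReal.ofReal (√K * h ^ (1 / 5 : ℝ)) ^ 2 := by
    refine hmain.trans ?_
    rw [← ENNReal.ofReal_pow (by positivity), mul_pow, Real.sq_sqrt hK0,
      ← Real.rpow_natCast (h ^ (1 / 5 : ℝ)), ← Real.rpow_mul h0.le]
    refine ENNReal.ofReal_le_ofReal ?_
    rw [NSF.l2_kernel ha]
    calc _ ≤ 2 * √(2 * E) * (h ^ (2 / 5 : ℝ)
          * (3 * NSF.bumpVar + 5 * (√(2 * E) * NSF.l2 NSF.bump) + 6) * (3 * (T + 1) + E)) := by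
          have := NSF.scale_bound (A := √(2 * E)) (β := NSF.l2 NSF.bump) hh hb
          have := hh.2.le
          gcongr
      _ = _ := by
          rw [hK]
          norm_num
          ring
  rw [eLpNorm_eq_lintegral_rpow_enorm_toReal (by norm_num) (by norm_num)]
  simp only [ENNReal.toReal_ofNat, ENNReal.rpow_ofNat]
  calc _ ≤ (ENNReal.ofReal (√K * h ^ (1 / 5 : ℝ)) ^ 2) ^ (1 / 2 : ℝ) := by gcongr
    _ = _ := by
        rw [← ENNReal.rpow_natCast, ← ENNReal.rpow_mul]
        norm_num
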